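/- Let $S,Y,Z$ denote random variables with finite state spaces. $I(\cdot\,;\cdot)$ and $I(\cdot\,;\cdot\mid\cdot)$ denote Shannon mutual information and conditional mutual information. For a joint distribution $P$ of $(S,Y,Z)$ define three measures of shared information, where $Q$ always ranges over random variables with an arbitrary finite state space: $$SI_\cap^{\wedge}(S;Y,Z)=\max\{I(Q;S) : Q=f(Y)=f'(Z)\ \text{a.s.}\},$$ the maximum being over all pairs of deterministic functions $f,f'$; $$SI_\cap^{GH}(S;Y,Z)=\max\{I(Q;S) : I(S;Q\mid Y)=I(S;Q\mid Z)=0\},$$ the maximum being over all joint distributions of $(S,Y,Z,Q)$ that extend $P$; $$SI_\cap^{*}(S;Y,Z)=\max\Big\{I(Q;S) : P(s,q)=\sum_y P(s,y)\lambda_{q|y}=\sum_z P(s,z)\lambda'_{q|z}\ \text{ for all } s,q\Big\},$$ the maximum being over all pairs of stochastic matrices $\lambda,\lambda'$ for which the two sums agree. Each $SI$ determines a decomposition consisting of $SI(S;Y,Z)$ and $$UI(S;Y\backslash Z)=I(S;Y)-SI(S;Y,Z),\qquad UI(S;Z\backslash Y)=I(S;Z)-SI(S;Y,Z),$$ $$CI(S;Y,Z)=I(S;YZ)-SI(S;Y,Z)-UI(S;Y\backslash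 Z)-UI(S;Z\backslash Y).$$ A function $J$ of the joint distribution of three finite random variables is called additive if $$J(S_1S_2,Y_1Y_2,Z_1Z_2)=J(S_1,Y_1,Z_1)+J(S_2,Y_2,Z_2)$$ whenever $(S_1,Y_1,Z_1)$ is independent of $(S_2,Y_2,Z_2)$; here $S_1S_2$ denotes the pair $(S_1,S_2)$, and so on. **Theorem.** The three maxima are attained, and the decompositions $I_\cap^{\wedge}$, $I_\cap^{GH}$ and $I_\cap^{*}$ are additive: for each of the three, $SI(S;Y,Z)$, $UI(S;Y\backslash Z)$, $UI(S;Z\backslash Y)$ and $CI(S;Y,Z)$ are all additive. -/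

import Mathlib

open MeasureTheory ProbabilityTheory

universe u v w x

noncomputable section

namespace InfoDecomp

/-- Mutual information `I(A;B)` (in nats) of a joint distribution `p a b` of two finite variables.
Summands with `p a b = 0` vanish. -/
def mutualInfo {A : Type*} {B : Type*} [Fintype A] [Fintype B] (p : A → B → ℝ) : ℝ :=
  ∑ a, ∑ b, p a b * Real.log (p a b / ((∑ b', p a b') * (∑ a', p a' b)))

/-- Conditional mutual information `I(A;B|C)` of a joint distribution `p a b c`, that is
`∑ p(a,b,c) log (p(a,b,c) p(c) / (p(a,c) p(b,c)))`. Summands with `p a b c = 0` vanish. -/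
def condMutualInfo {A : Type*} {B : Type*} {C : Type*} [Fintype A] [Fintype B] [Fintype C]
    (p : A → B → C → ℝ) : ℝ :=
  ∑ a, ∑ b, ∑ c, p a b c *
    Real.log (p a b c * (∑ a', ∑ b', p a' b' c) / ((∑ b', p a b' c) * (∑ a', p a' b c)))

/-- A function of the joint distribution of three finite variables `S, Y, Z`, the distribution
being given by its probability mass function (an element of `stdSimplex ℝ (S × Y × Z)`). -/
def InfoMeasure : Type (max (u + 1) (v + 1) (w + 1)) :=
  ∀ (S : Type u) (Y : Type v) (Z : Type w) [Fintype S] [Fintype Y] [Fintype Z],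
    (S × Y × Z → ℝ) → ℝ

section Shared

variable {S : Type u} {Y : Type v} {Z : Type w} [Fintype S] [Fintype Y] [Fintype Z]

/-- The `(S,Y)`-marginal. -/
def margSY (P : S × Y × Z → ℝ) (s : S) (y : Y) : ℝ := ∑ z, P (s, y, z)

/-- The `(S,Z)`-marginal. -/
def margSZ (P : S × Y × Z → ℝ) (s : S) (z : Z) : ℝ := ∑ y, P (s, y, z)

/-- The values `I(Q;S)` where `Q = f(Y) = f'(Z)` almost surely, with `f, f'` deterministic functions
into a finite set. -/
def wedgeValues (P : S × Y × Z → ℝ) : Set ℝ :=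
  {r | ∃ (k : ℕ) (f : Y → Fin k) (f' : Z → Fin k),
    (∀ s y z, P (s, y, z) ≠ 0 → f y = f' z) ∧
    r = mutualInfo (fun (q : Fin k) (s : S) => ∑ y, ∑ z, if f y = q then P (s, y, z) else 0)}

/-- The values `I(Q;S)` where `R` is a joint distribution of `S, Y, Z, Q` (with `Q` finite) that
extends `P` and satisfies `I(S;Q|Y) = I(S;Q|Z) = 0`. -/
def ghValues (P : S × Y × Z → ℝ) : Set ℝ :=
  {r | ∃ (k : ℕ) (R : S × Y × Z × Fin k → ℝ),
    R ∈ stdSimplex ℝ (S × Y × Z × Fin k) ∧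
    (∀ s y z, ∑ q, R (s, y, z, q) = P (s, y, z)) ∧
    condMutualInfo (fun (s : S) (q : Fin k) (y : Y) => ∑ z, R (s, y, z, q)) = 0 ∧
    condMutualInfo (fun (s : S) (q : Fin k) (z : Z) => ∑ y, R (s, y, z, q)) = 0 ∧
    r = mutualInfo (fun (q : Fin k) (s : S) => ∑ y, ∑ z, R (s, y, z, q))}

/-- The values `I(Q;S)` where the joint distribution of `S` and a finite `Q` satisfies
`P(s,q) = ∑ y, P(s,y) l(q|y) = ∑ z, P(s,z) l'(q|z)` for stochastic matrices `l, l'`. -/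
def starValues (P : S × Y × Z → ℝ) : Set ℝ :=
  {r | ∃ (k : ℕ) (l : Y → Fin k → ℝ) (l' : Z → Fin k → ℝ),
    (∀ y, l y ∈ stdSimplex ℝ (Fin k)) ∧ (∀ z, l' z ∈ stdSimplex ℝ (Fin k)) ∧
    (∀ s q, ∑ y, margSY P s y * l y q = ∑ z, margSZ P s z * l' z q) ∧
    r = mutualInfo (fun (q : Fin k) (s : S) => ∑ y, margSY P s y * l y q)}

end Shared

/-- Shared information `SI_∩^∧(S;Y,Z)`. -/
def SIwedge : InfoMeasure.{u, v, w} := fun _ _ _ _ _ _ P => sSup (wedgeValues P)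

/-- Shared information `SI_∩^GH(S;Y,Z)`. -/
def SIgh : InfoMeasure.{u, v, w} := fun _ _ _ _ _ _ P => sSup (ghValues P)

/-- Shared information `SI_∩^*(S;Y,Z)`. -/
def SIstar : InfoMeasure.{u, v, w} := fun _ _ _ _ _ _ P => sSup (starValues P)

/-- Unique information `UI(S;Y∖Z) = I(S;Y) - SI(S;Y,Z)` of the decomposition given by `SI`. -/
def uniqueY (SI : InfoMeasure.{u, v, w}) : InfoMeasure.{u, v, w} :=
  fun S Y Z _ _ _ P => mutualInfo (margSY P) - SI S Y Z P

/-- Unique information `UI(S;Z∖Y) = I(S;Z) - SI(S;Y,Z)` of the decomposition given by `SI`. -/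
def uniqueZ (SI : InfoMeasure.{u, v, w}) : InfoMeasure.{u, v, w} :=
  fun S Y Z _ _ _ P => mutualInfo (margSZ P) - SI S Y Z P

/-- Complementary information `CI = I(S;YZ) - SI - UI(S;Y∖Z) - UI(S;Z∖Y)` of the decomposition
given by `SI`. -/
def complementary (SI : InfoMeasure.{u, v, w}) : InfoMeasure.{u, v, w} :=
  fun S Y Z _ _ _ P =>
    mutualInfo (fun (s : S) (yz : Y × Z) => P (s, yz)) - SI S Y Z P
      - uniqueY SI S Y Z P - uniqueZ SI S Y Z P

/-- The probability mass function of `(S, Y, Z)` under `μ`. -/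
def jointLaw {Ω : Type x} [MeasurableSpace Ω] (μ : Measure Ω) {A : Type u} {B : Type v} {C : Type w}
    (S : Ω → A) (Y : Ω → B) (Z : Ω → C) : A × B × C → ℝ :=
  fun t => μ.real {ω | (S ω, Y ω, Z ω) = t}

/-- Additivity: if `(S₁, Y₁, Z₁)` is independent of `(S₂, Y₂, Z₂)`, then
`I(S₁S₂, Y₁Y₂, Z₁Z₂) = I(S₁, Y₁, Z₁) + I(S₂, Y₂, Z₂)`. -/
def IsAdditive (I : InfoMeasure.{u, v, w}) : Prop :=
  ∀ (Ω : Type x) [MeasurableSpace Ω] (μ : Measure Ω) [IsProbabilityMeasure μ]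
    (A₁ A₂ : Type u) (B₁ B₂ : Type v) (C₁ C₂ : Type w)
    [Fintype A₁] [Fintype A₂] [Fintype B₁] [Fintype B₂] [Fintype C₁] [Fintype C₂]
    [MeasurableSpace A₁] [MeasurableSpace A₂] [MeasurableSpace B₁] [MeasurableSpace B₂]
    [MeasurableSpace C₁] [MeasurableSpace C₂]
    [DiscreteMeasurableSpace A₁] [DiscreteMeasurableSpace A₂]
    [DiscreteMeasurableSpace B₁] [DiscreteMeasurableSpace B₂]
    [DiscreteMeasurableSpace C₁] [DiscreteMeasurableSpace C₂]
    (S₁ : Ω → A₁) (S₂ : Ω → A₂) (Y₁ : Ω → B₁) (Y₂ : Ω → B₂) (Z₁ : Ω → C₁) (Z₂ : Ω → C₂),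
    Measurable S₁ → Measurable S₂ → Measurable Y₁ → Measurable Y₂ →
    Measurable Z₁ → Measurable Z₂ →
    IndepFun (fun ω => (S₁ ω, Y₁ ω, Z₁ ω)) (fun ω => (S₂ ω, Y₂ ω, Z₂ ω)) μ →
    I (A₁ × A₂) (B₁ × B₂) (C₁ × C₂)
        (jointLaw μ (fun ω => (S₁ ω, S₂ ω)) (fun ω => (Y₁ ω, Y₂ ω)) (fun ω => (Z₁ ω, Z₂ ω)))
      = I A₁ B₁ C₁ (jointLaw μ S₁ Y₁ Z₁) + I A₂ B₂ C₂ (jointLaw μ S₂ Y₂ Z₂)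

/-- The decomposition determined by the shared information `SI` is additive: shared, both unique
and complementary information are additive. -/
def IsAdditiveDecomposition (SI : InfoMeasure.{u, v, w}) : Prop :=
  IsAdditive.{u, v, w, x} SI ∧ IsAdditive.{u, v, w, x} (uniqueY SI) ∧
    IsAdditive.{u, v, w, x} (uniqueZ SI) ∧ IsAdditive.{u, v, w, x} (complementary SI)

end InfoDecomp

end

/-!
For independent triples the chain rule gives `I(Q;S₁S₂) = I(Q;S₁) + I(Q;S₂|S₁)`. For `GH` and `*`,
averaging out the second triple turns a variable `Q` admissible for the product into one admissible
for the first triple, and fixing `S₁ = s₁` and averaging out the rest of the first triple turns it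
into one admissible for the second. For `∧` averaging leaves the class of deterministic functions,
but fixing `Y₂` (or `Y₁`) does not, and `I(Q;S)` is convex in the channel that produces `Q`, so an
average of admissible values bounds the value of the averaged channel. The reverse inequality comes
from independent optimal variables `Q₁`, `Q₂`.

The maximum for `∧` runs over finitely many partitions. For `GH` and `*` the variables `Q`
correspond to the decompositions of a fixed vector `b` within a closed cone, and `I(Q;S)` is a sum
of contributions `φ (v q)` of the terms, with `φ` continuous and homogeneous. Normalising the terms,
the pairs `(b, I(Q;S))` form the slice over `b` of the convex hull of the graph of `φ` on a
compact set, which is compact although the number of values of `Q` is not bounded.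
-/

namespace InfoDecomp

open InformationTheory (klFun)

section RelativeEntropy

variable {ι : Type*} [Fintype ι] {f g : ι → ℝ}

theorem sum_ne_zero_of_nonneg (hf : ∀ i, 0 ≤ f i) {i : ι} (hi : f i ≠ 0) : ∑ j, f j ≠ 0 :=
  fun h => hi (congrFun ((Fintype.sum_eq_zero_iff_of_nonneg hf).1 h) i)

theorem mul_log_div_eq_mul_klFun {x y : ℝ} (h : y = 0 → x = 0) :
    x * Real.log (x / y) = y * klFun (x / y) + (x - y) := by
  rcases eq_or_ne y 0 with rfl | hy
  · simp [h rfl]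
  · rw [InformationTheory.klFun_apply]
    field_simp
    ring

theorem sum_mul_log_div_eq_zero_iff (hf : ∀ i, 0 ≤ f i) (hg : ∀ i, 0 ≤ g i)
    (hfg : ∀ i, g i = 0 → f i = 0) (hsum : ∑ i, f i = ∑ i, g i) :
    ∑ i, f i * Real.log (f i / g i) = 0 ↔ f = g := by
  have hkl : ∑ i, f i * Real.log (f i / g i) = ∑ i, g i * klFun (f i / g i) := by
    simp only [mul_log_div_eq_mul_klFun (hfg _), Finset.sum_add_distrib, Finset.sum_sub_distrib,
      hsum, sub_self, add_zero]
  have hnonneg : ∀ i, 0 ≤ g i * klFun (f i / g i) := fun i =>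
    mul_nonneg (hg i) (InformationTheory.klFun_nonneg (div_nonneg (hf i) (hg i)))
  rw [hkl, Fintype.sum_eq_zero_iff_of_nonneg hnonneg, funext_iff, funext_iff]
  refine forall_congr' fun i => ?_
  rw [Pi.zero_apply, mul_eq_zero,
    InformationTheory.klFun_eq_zero_iff (div_nonneg (hf i) (hg i))]
  rcases eq_or_ne (g i) 0 with h | h
  · simp [h, hfg i h]
  · simp [h, div_eq_one_iff_eq h]

theorem sum_mul_log_sum_div_sum_le (hf : ∀ i, 0 ≤ f i) (hg : ∀ i, 0 ≤ g i)
    (hfg : ∀ i, g i = 0 → f i = 0) :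
    (∑ i, f i) * Real.log ((∑ i, f i) / ∑ i, g i) ≤ ∑ i, f i * Real.log (f i / g i) := by
  rcases eq_or_ne (∑ i, f i) 0 with hF | hF
  · have hf0 : f = 0 := (Fintype.sum_eq_zero_iff_of_nonneg hf).1 hF
    simp [hf0]
  have hG : ∑ i, g i ≠ 0 := fun h => hF <| Finset.sum_eq_zero fun i _ =>
    hfg i (congrFun ((Fintype.sum_eq_zero_iff_of_nonneg hg).1 h) i)
  set c := (∑ i, f i) / ∑ i, g i with hc
  have hc0 : c ≠ 0 := div_ne_zero hF hG
  have hcg : ∀ i, 0 ≤ c * g i := fun i => mul_nonneg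
    (div_nonneg (Finset.sum_nonneg fun i _ => hf i) (Finset.sum_nonneg fun i _ => hg i)) (hg i)
  have hterm : ∀ i, f i * Real.log c + (f i - c * g i) ≤ f i * Real.log (f i / g i) := by
    intro i
    rcases eq_or_ne (f i) 0 with h | h
    · simpa [h] using hcg i
    have hgi : g i ≠ 0 := mt (hfg i) h
    have hlog : Real.log (f i / (c * g i)) = Real.log (f i / g i) - Real.log c := by
      rw [mul_comm, ← div_div, Real.log_div (div_ne_zero h hgi) hc0]
    have hscaled := mul_log_div_eq_mul_klFun (x := f i) (y := c * g i) (by simp [hc0, hgi])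
    have hkl : 0 ≤ c * g i * klFun (f i / (c * g i)) :=
      mul_nonneg (hcg i) (InformationTheory.klFun_nonneg (div_nonneg (hf i) (hcg i)))
    rw [hlog] at hscaled
    linarith
  calc (∑ i, f i) * Real.log c = ∑ i, (f i * Real.log c + (f i - c * g i)) := by
        rw [Finset.sum_add_distrib, Finset.sum_sub_distrib, ← Finset.sum_mul, ← Finset.mul_sum,
          hc, div_mul_cancel₀ _ hG, sub_self, add_zero]
    _ ≤ ∑ i, f i * Real.log (f i / g i) := Finset.sum_le_sum fun i _ => hterm i

theorem sum_mul_le_of_mem_stdSimplex {w : ι → ℝ} {c : ℝ} (hw : w ∈ stdSimplex ℝ ι)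
    (h : ∀ i, w i ≠ 0 → f i ≤ c) : ∑ i, w i * f i ≤ c := by
  calc ∑ i, w i * f i ≤ ∑ i, w i * c := Finset.sum_le_sum fun i _ => by
        rcases eq_or_ne (w i) 0 with h0 | h0
        · simp [h0]
        · exact mul_le_mul_of_nonneg_left (h i h0) (hw.1 i)
    _ = c := by rw [← Finset.sum_mul, hw.2, one_mul]

end RelativeEntropy

section ConditionalMutualInfo

variable {A B C : Type*} [Fintype A] [Fintype B]

/-- The law with the same `(A,C)`- and `(B,C)`-marginals as `p` for which `A` and `B` are
conditionally independent given `C`. It is `0` where the law of `C` vanishes, as `x / 0 = 0`. -/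
noncomputable def condIndepLaw (p : A → B → C → ℝ) (a : A) (b : B) (c : C) : ℝ :=
  (∑ b', p a b' c) * (∑ a', p a' b c) / ∑ a', ∑ b', p a' b' c

variable {p : A → B → C → ℝ}

theorem condIndepLaw_nonneg (hp : ∀ a b c, 0 ≤ p a b c) (a : A) (b : B) (c : C) :
    0 ≤ condIndepLaw p a b c :=
  div_nonneg
    (mul_nonneg (Finset.sum_nonneg fun _ _ => hp _ _ _) (Finset.sum_nonneg fun _ _ => hp _ _ _))
    (Finset.sum_nonneg fun _ _ => Finset.sum_nonneg fun _ _ => hp _ _ _)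

theorem eq_zero_of_condIndepLaw_eq_zero (hp : ∀ a b c, 0 ≤ p a b c) {a : A} {b : B} {c : C}
    (h : condIndepLaw p a b c = 0) : p a b c = 0 := by
  by_contra hne
  have hx : ∑ b', p a b' c ≠ 0 := sum_ne_zero_of_nonneg (fun b' => hp a b' c) hne
  have hy : ∑ a', p a' b c ≠ 0 := sum_ne_zero_of_nonneg (fun a' => hp a' b c) hne
  have hm : ∑ a', ∑ b', p a' b' c ≠ 0 :=
    sum_ne_zero_of_nonneg (fun a' => Finset.sum_nonneg fun b' _ => hp a' b' c) hx
  exact div_ne_zero (mul_ne_zero hx hy) hm h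

theorem sum_condIndepLaw (hp : ∀ a b c, 0 ≤ p a b c) (a : A) (c : C) :
    ∑ b, condIndepLaw p a b c = ∑ b, p a b c := by
  have hsum : ∑ b, ∑ a', p a' b c = ∑ a', ∑ b', p a' b' c := Finset.sum_comm
  simp only [condIndepLaw]
  rw [← Finset.sum_div, ← Finset.mul_sum, hsum]
  refine mul_div_cancel_of_imp fun h => ?_
  exact congrFun ((Fintype.sum_eq_zero_iff_of_nonneg
    fun a' => Finset.sum_nonneg fun b' _ => hp a' b' c).1 h) a

variable [Fintype C]

theorem condMutualInfo_eq_sum_mul_log_div (p : A → B → C → ℝ) :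
    condMutualInfo p = ∑ a, ∑ b, ∑ c, p a b c * Real.log (p a b c / condIndepLaw p a b c) := by
  simp only [condMutualInfo, condIndepLaw, div_div_eq_mul_div]

theorem condMutualInfo_eq_zero_iff_eq_condIndepLaw (hp : ∀ a b c, 0 ≤ p a b c) :
    condMutualInfo p = 0 ↔ p = condIndepLaw p := by
  have hsum : ∑ t : A × B × C, p t.1 t.2.1 t.2.2
      = ∑ t : A × B × C, condIndepLaw p t.1 t.2.1 t.2.2 := by
    simp only [Fintype.sum_prod_type]
    refine Finset.sum_congr rfl fun a _ => ?_
    rw [Finset.sum_comm, Finset.sum_comm (f := fun b c => condIndepLaw p a b c)]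
    simp only [sum_condIndepLaw hp]
  have hgibbs := sum_mul_log_div_eq_zero_iff (fun t : A × B × C => hp t.1 t.2.1 t.2.2)
    (fun t => condIndepLaw_nonneg hp t.1 t.2.1 t.2.2)
    (fun t => eq_zero_of_condIndepLaw_eq_zero hp) hsum
  simp only [Fintype.sum_prod_type] at hgibbs
  rw [condMutualInfo_eq_sum_mul_log_div, hgibbs]
  simp only [funext_iff, Prod.forall]

theorem condMutualInfo_eq_zero_iff (hp : ∀ a b c, 0 ≤ p a b c) :
    condMutualInfo p = 0 ↔ ∃ l : B → C → ℝ, ∀ a b c, p a b c = (∑ b', p a b' c) * l b c := by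
  rw [condMutualInfo_eq_zero_iff_eq_condIndepLaw hp]
  constructor
  · intro h
    refine ⟨fun b c => (∑ a', p a' b c) / ∑ a', ∑ b', p a' b' c, fun a b c => ?_⟩
    rw [← mul_div_assoc]
    exact congrFun (congrFun (congrFun h a) b) c
  · rintro ⟨l, hl⟩
    ext a b c
    have hy : ∑ a', p a' b c = (∑ a', ∑ b', p a' b' c) * l b c := by
      rw [Finset.sum_mul]
      exact Finset.sum_congr rfl fun a' _ => hl a' b c
    rcases eq_or_ne (∑ a', ∑ b', p a' b' c) 0 with hm | hm
    · have hx : ∑ b', p a b' c = 0 := congrFun ((Fintype.sum_eq_zero_iff_of_nonneg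
        fun a' => Finset.sum_nonneg fun b' _ => hp a' b' c).1 hm) a
      rw [condIndepLaw, hm, div_zero, hl, hx, zero_mul]
    · rw [condIndepLaw, hy, mul_left_comm, mul_div_cancel_left₀ _ hm, hl]

theorem condMutualInfo_eq_sum_mul_mutualInfo (hp : ∀ a b c, 0 ≤ p a b c) :
    condMutualInfo p = ∑ c, (∑ a, ∑ b, p a b c) *
      mutualInfo (fun a b => p a b c / ∑ a, ∑ b, p a b c) := by
  have hcomm : condMutualInfo p = ∑ c, ∑ a, ∑ b, p a b c * Real.log (p a b c *
      (∑ a', ∑ b', p a' b' c) / ((∑ b', p a b' c) * (∑ a', p a' b c))) := by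
    rw [Finset.sum_comm]
    exact Finset.sum_congr rfl fun a _ => Finset.sum_comm
  rw [hcomm]
  refine Finset.sum_congr rfl fun c _ => ?_
  rw [mutualInfo, Finset.mul_sum]
  refine Finset.sum_congr rfl fun a _ => ?_
  rw [Finset.mul_sum]
  refine Finset.sum_congr rfl fun b _ => ?_
  rcases eq_or_ne (p a b c) 0 with h | h
  · simp [h]
  have hm : ∑ a', ∑ b', p a' b' c ≠ 0 :=
    sum_ne_zero_of_nonneg (fun a' => Finset.sum_nonneg fun b' _ => hp a' b' c)
      (sum_ne_zero_of_nonneg (fun b' => hp a b' c) h)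
  rw [← Finset.sum_div, ← Finset.sum_div]
  field_simp

end ConditionalMutualInfo

section MutualInfo

variable {A A' B B' : Type*} [Fintype A] [Fintype A'] [Fintype B] [Fintype B']

theorem mutualInfo_comp_equiv (e : A' ≃ A) (e' : B' ≃ B) (p : A → B → ℝ) :
    mutualInfo (fun a b => p (e a) (e' b)) = mutualInfo p := by
  unfold mutualInfo
  rw [← e.sum_comp]
  refine Finset.sum_congr rfl fun a _ => ?_
  rw [← e'.sum_comp]
  refine Finset.sum_congr rfl fun b _ => ?_
  rw [← e'.sum_comp (fun b' => p (e a) b'), ← e.sum_comp (fun a' => p a' (e' b))]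

theorem mutualInfo_comp_of_injective {g : A' → A} (hg : Function.Injective g) {p : A → B → ℝ}
    (hp : ∀ a ∉ Set.range g, p a = 0) : mutualInfo (fun a b => p (g a) b) = mutualInfo p := by
  have hsum : ∀ b, ∑ a', p (g a') b = ∑ a, p a b := fun b =>
    Fintype.sum_of_injective g hg _ _ (fun a ha => congrFun (hp a ha) b) fun _ => rfl
  refine Fintype.sum_of_injective g hg _ _ (fun a ha => ?_) fun a => ?_
  · simp [hp a ha]
  · simp only [hsum]

/-- The contribution of one value `q` of `Q` to `I(Q;S)`, as a function of the vector
`v s = P(q,s)`, where `b` is the law of `S`. It is written with `Real.negMulLog`, so that it is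
continuous on the whole space of vectors. -/
noncomputable def pointwiseInfo (b v : B → ℝ) : ℝ :=
  (∑ s, (-(v s).negMulLog - v s * Real.log (b s))) + (∑ s, v s).negMulLog

theorem continuous_pointwiseInfo (b : B → ℝ) : Continuous (pointwiseInfo b) := by
  unfold pointwiseInfo
  fun_prop

theorem pointwiseInfo_smul (b : B → ℝ) (t : ℝ) (v : B → ℝ) :
    pointwiseInfo b (t • v) = t * pointwiseInfo b v := by
  simp only [pointwiseInfo, Pi.smul_apply, smul_eq_mul, ← Finset.mul_sum, Real.negMulLog_mul]
  have hterm : ∀ s, -(v s * t.negMulLog + t * (v s).negMulLog) - t * v s * Real.log (b s)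
      = t * (-(v s).negMulLog - v s * Real.log (b s)) - v s * t.negMulLog := fun s => by ring
  simp only [hterm, Finset.sum_sub_distrib, ← Finset.mul_sum, ← Finset.sum_mul]
  ring

theorem pointwiseInfo_eq_sum_mul_log_div {b v : B → ℝ} (hv : ∀ s, 0 ≤ v s)
    (hvb : ∀ s, b s = 0 → v s = 0) :
    pointwiseInfo b v = ∑ s, v s * Real.log (v s / ((∑ s', v s') * b s)) := by
  have htotal : (∑ s, v s).negMulLog = ∑ s, -(v s * Real.log (∑ s', v s')) := by
    rw [Finset.sum_neg_distrib, ← Finset.sum_mul, Real.negMulLog, neg_mul]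
  rw [pointwiseInfo, htotal, ← Finset.sum_add_distrib]
  refine Finset.sum_congr rfl fun s _ => ?_
  rcases eq_or_ne (v s) 0 with h | h
  · simp [h]
  have hb : b s ≠ 0 := mt (hvb s) h
  have hsum : ∑ s', v s' ≠ 0 := sum_ne_zero_of_nonneg hv h
  rw [Real.log_div h (mul_ne_zero hsum hb), Real.log_mul hsum hb, Real.negMulLog]
  ring

theorem mutualInfo_eq_sum_pointwiseInfo {p : A → B → ℝ} {b : B → ℝ} (hp : ∀ q s, 0 ≤ p q s)
    (hb : ∀ s, ∑ q, p q s = b s) : mutualInfo p = ∑ q, pointwiseInfo b (p q) := by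
  refine Finset.sum_congr rfl fun q _ => ?_
  have hac : ∀ s, b s = 0 → p q s = 0 := fun s h =>
    congrFun ((Fintype.sum_eq_zero_iff_of_nonneg fun q => hp q s).1 ((hb s).trans h)) q
  simp only [pointwiseInfo_eq_sum_mul_log_div (hp q) hac, hb]

theorem pointwiseInfo_sum_le {ι : Type*} [Fintype ι] {b : B → ℝ} {v : ι → B → ℝ}
    (hb : ∀ s, 0 ≤ b s) (hv : ∀ i s, 0 ≤ v i s) (hvb : ∀ i s, b s = 0 → v i s = 0) :
    pointwiseInfo b (∑ i, v i) ≤ ∑ i, pointwiseInfo b (v i) := by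
  have hsum : ∀ s, 0 ≤ (∑ i, v i) s := fun s => by
    rw [Finset.sum_apply]
    exact Finset.sum_nonneg fun i _ => hv i s
  have hsum_ac : ∀ s, b s = 0 → (∑ i, v i) s = 0 := fun s h => by
    rw [Finset.sum_apply]
    exact Finset.sum_eq_zero fun i _ => hvb i s h
  rw [pointwiseInfo_eq_sum_mul_log_div hsum hsum_ac]
  simp only [pointwiseInfo_eq_sum_mul_log_div (hv _) (hvb _)]
  rw [Finset.sum_comm]
  refine Finset.sum_le_sum fun s _ => ?_
  have htotal : (∑ s', (∑ i, v i) s') * b s = ∑ i, (∑ s', v i s') * b s := by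
    simp only [Finset.sum_apply]
    rw [Finset.sum_comm, Finset.sum_mul]
  rw [htotal, Finset.sum_apply]
  refine sum_mul_log_sum_div_sum_le (fun i => hv i s)
    (fun i => mul_nonneg (Finset.sum_nonneg fun s' _ => hv i s') (hb s)) fun i h => ?_
  rcases mul_eq_zero.1 h with h | h
  · exact congrFun ((Fintype.sum_eq_zero_iff_of_nonneg (hv i)).1 h) s
  · exact hvb i s h

theorem mutualInfo_sum_mul_le {ι : Type*} [Fintype ι] {w : ι → ℝ} {p : ι → A → B → ℝ} {b : B → ℝ}
    (hw : w ∈ stdSimplex ℝ ι) (hp : ∀ i q s, 0 ≤ p i q s) (hb : ∀ i s, ∑ q, p i q s = b s) :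
    mutualInfo (fun q s => ∑ i, w i * p i q s) ≤ ∑ i, w i * mutualInfo (p i) := by
  rcases isEmpty_or_nonempty ι with hι | ⟨⟨i₀⟩⟩
  · exact absurd hw.2 (by simp)
  have hb_nonneg : ∀ s, 0 ≤ b s := fun s => hb i₀ s ▸ Finset.sum_nonneg fun q _ => hp i₀ q s
  have hac : ∀ i q s, b s = 0 → p i q s = 0 := fun i q s h =>
    congrFun ((Fintype.sum_eq_zero_iff_of_nonneg fun q => hp i q s).1 ((hb i s).trans h)) q
  have hmix : ∀ s, ∑ q, ∑ i, w i * p i q s = b s := fun s => by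
    rw [Finset.sum_comm]
    simp only [← Finset.mul_sum, hb, ← Finset.sum_mul, hw.2, one_mul]
  calc mutualInfo (fun q s => ∑ i, w i * p i q s)
      = ∑ q, pointwiseInfo b (∑ i, w i • p i q) := by
        rw [mutualInfo_eq_sum_pointwiseInfo
          (fun q s => Finset.sum_nonneg fun i _ => mul_nonneg (hw.1 i) (hp i q s)) hmix]
        refine Finset.sum_congr rfl fun q _ => congrArg _ ?_
        ext s
        simp only [Finset.sum_apply, Pi.smul_apply, smul_eq_mul]
    _ ≤ ∑ q, ∑ i, pointwiseInfo b (w i • p i q) := Finset.sum_le_sum fun q _ =>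
        pointwiseInfo_sum_le hb_nonneg (fun i s => mul_nonneg (hw.1 i) (hp i q s))
          fun i s h => mul_eq_zero_of_right _ (hac i q s h)
    _ = ∑ i, w i * mutualInfo (p i) := by
        rw [Finset.sum_comm]
        simp only [mutualInfo_eq_sum_pointwiseInfo (hp _) (hb _), pointwiseInfo_smul,
          Finset.mul_sum]

theorem mutualInfo_prod_eq_add_condMutualInfo {p : A → B × B' → ℝ} (hp : ∀ q s, 0 ≤ p q s) :
    mutualInfo p = mutualInfo (fun q s₁ => ∑ s₂, p q (s₁, s₂))
      + condMutualInfo (fun q s₂ s₁ => p q (s₁, s₂)) := by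
  have hswap : condMutualInfo (fun q s₂ s₁ => p q (s₁, s₂)) = ∑ q, ∑ s₁, ∑ s₂, p q (s₁, s₂) *
      Real.log (p q (s₁, s₂) * (∑ q', ∑ s₂', p q' (s₁, s₂')) /
        ((∑ s₂', p q (s₁, s₂')) * ∑ q', p q' (s₁, s₂))) :=
    Finset.sum_congr rfl fun q _ => Finset.sum_comm
  rw [hswap, mutualInfo, mutualInfo, ← Finset.sum_add_distrib]
  refine Finset.sum_congr rfl fun q _ => ?_
  rw [Fintype.sum_prod_type, ← Finset.sum_add_distrib]
  refine Finset.sum_congr rfl fun s₁ _ => ?_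
  rw [Finset.sum_mul, ← Finset.sum_add_distrib]
  refine Finset.sum_congr rfl fun s₂ _ => ?_
  rcases eq_or_ne (p q (s₁, s₂)) 0 with h | h
  · simp [h]
  have hqs₁ : ∑ s₂', p q (s₁, s₂') ≠ 0 :=
    sum_ne_zero_of_nonneg (fun s₂' => hp q (s₁, s₂')) h
  have hq : ∑ s₁', ∑ s₂', p q (s₁', s₂') ≠ 0 := sum_ne_zero_of_nonneg
    (fun s₁' => Finset.sum_nonneg fun s₂' _ => hp q (s₁', s₂')) hqs₁
  have hs₁ : ∑ q', ∑ s₂', p q' (s₁, s₂') ≠ 0 := sum_ne_zero_of_nonneg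
    (fun q' => Finset.sum_nonneg fun s₂' _ => hp q' (s₁, s₂')) hqs₁
  have hs₁s₂ : ∑ q', p q' (s₁, s₂) ≠ 0 := sum_ne_zero_of_nonneg (fun q' => hp q' (s₁, s₂)) h
  rw [Fintype.sum_prod_type, ← mul_add, ← Real.log_mul
    (div_ne_zero hqs₁ (mul_ne_zero hq hs₁))
    (div_ne_zero (mul_ne_zero h hs₁) (mul_ne_zero hqs₁ hs₁s₂))]
  congr 2
  field_simp

theorem mutualInfo_prod_le_add {p : A → B × B' → ℝ} {c₁ c₂ : ℝ} (hp : ∀ q s, 0 ≤ p q s)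
    (hp1 : ∑ q, ∑ s, p q s = 1)
    (h₁ : mutualInfo (fun q s₁ => ∑ s₂, p q (s₁, s₂)) ≤ c₁)
    (h₂ : ∀ s₁, ∑ q, ∑ s₂, p q (s₁, s₂) ≠ 0 →
      mutualInfo (fun q s₂ => p q (s₁, s₂) / ∑ q, ∑ s₂, p q (s₁, s₂)) ≤ c₂) :
    mutualInfo p ≤ c₁ + c₂ := by
  have hlaw : (fun s₁ => ∑ q, ∑ s₂, p q (s₁, s₂)) ∈ stdSimplex ℝ B := by
    refine ⟨fun s₁ => Finset.sum_nonneg fun q _ => Finset.sum_nonneg fun s₂ _ => hp q _, ?_⟩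
    rw [Finset.sum_comm, ← hp1]
    simp only [Fintype.sum_prod_type]
  rw [mutualInfo_prod_eq_add_condMutualInfo hp,
    condMutualInfo_eq_sum_mul_mutualInfo fun q s₂ s₁ => hp q (s₁, s₂)]
  exact add_le_add h₁ (sum_mul_le_of_mem_stdSimplex hlaw h₂)

end MutualInfo

section Kron

variable {A A' B B' : Type*}

/-- The Kronecker product of two matrices, which is the law of the pairs `(A,A')` and `(B,B')` when
`(A,B)` and `(A',B')` are independent with laws `p` and `p'`. -/
def kron (p : A → B → ℝ) (p' : A' → B' → ℝ) (a : A × A') (b : B × B') : ℝ :=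
  p a.1 b.1 * p' a.2 b.2

theorem sum_prod_mul [Fintype A] [Fintype A'] (f : A → ℝ) (g : A' → ℝ) :
    ∑ a : A × A', f a.1 * g a.2 = (∑ a, f a) * ∑ a, g a := by
  rw [Fintype.sum_prod_type, Finset.sum_mul_sum]

theorem sum_sum_kron [Fintype A] [Fintype A'] [Fintype B] [Fintype B'] (p : A → B → ℝ)
    (p' : A' → B' → ℝ) :
    ∑ a, ∑ b, kron p p' a b = (∑ a, ∑ b, p a b) * ∑ a, ∑ b, p' a b := by
  rw [← sum_prod_mul]
  exact Finset.sum_congr rfl fun a _ => sum_prod_mul (p a.1) (p' a.2)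

/-- `p` is the joint law of two finite variables. -/
structure IsJointLaw [Fintype A] [Fintype B] (p : A → B → ℝ) : Prop where
  nonneg : ∀ a b, 0 ≤ p a b
  sum_eq_one : ∑ a, ∑ b, p a b = 1

variable [Fintype A] [Fintype A'] [Fintype B] [Fintype B']

theorem isJointLaw_of_mem_stdSimplex {P : A × B → ℝ} (hP : P ∈ stdSimplex ℝ (A × B)) :
    IsJointLaw fun a b => P (a, b) where
  nonneg a b := hP.1 (a, b)
  sum_eq_one := by rw [← Fintype.sum_prod_type, hP.2]

theorem IsJointLaw.kron {p : A → B → ℝ} {p' : A' → B' → ℝ} (hp : IsJointLaw p)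
    (hp' : IsJointLaw p') : IsJointLaw (kron p p') where
  nonneg a b := mul_nonneg (hp.nonneg a.1 b.1) (hp'.nonneg a.2 b.2)
  sum_eq_one := by rw [sum_sum_kron, hp.sum_eq_one, hp'.sum_eq_one, mul_one]

theorem mutualInfo_kron {p : A → B → ℝ} {p' : A' → B' → ℝ} (hp : IsJointLaw p)
    (hp' : IsJointLaw p') : mutualInfo (kron p p') = mutualInfo p + mutualInfo p' := by
  let i (a : A) (b : B) : ℝ := Real.log (p a b / ((∑ b', p a b') * ∑ a', p a' b))
  let i' (a : A') (b : B') : ℝ := Real.log (p' a b / ((∑ b', p' a b') * ∑ a', p' a' b))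
  have hterm : ∀ a b, kron p p' a b * Real.log (kron p p' a b /
      ((∑ b', kron p p' a b') * ∑ a', kron p p' a' b))
      = kron (fun a b => p a b * i a b) p' a b + kron p (fun a b => p' a b * i' a b) a b := by
    rintro ⟨a, a'⟩ ⟨b, b'⟩
    simp only [kron, i, i', sum_prod_mul (p a) (p' a'),
      sum_prod_mul (fun a => p a b) fun a' => p' a' b']
    rcases eq_or_ne (p a b) 0 with h | h
    · simp [h]
    rcases eq_or_ne (p' a' b') 0 with h' | h'
    · simp [h']
    have ha := sum_ne_zero_of_nonneg (hp.nonneg a) h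
    have hb := sum_ne_zero_of_nonneg (fun a => hp.nonneg a b) h
    have ha' := sum_ne_zero_of_nonneg (hp'.nonneg a') h'
    have hb' := sum_ne_zero_of_nonneg (fun a => hp'.nonneg a b') h'
    rw [mul_mul_mul_comm (∑ b', p a b'), mul_div_mul_comm,
      Real.log_mul (div_ne_zero h (mul_ne_zero ha hb)) (div_ne_zero h' (mul_ne_zero ha' hb'))]
    ring
  rw [mutualInfo]
  simp only [hterm, Finset.sum_add_distrib, sum_sum_kron, hp.sum_eq_one, hp'.sum_eq_one, mul_one,
    one_mul]
  rfl

end Kron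

section Decomposition

theorem isCompact_convexHull_of_finiteDimensional {E : Type*} [AddCommGroup E] [Module ℝ E]
    [FiniteDimensional ℝ E] [TopologicalSpace E] [ContinuousAdd E] [ContinuousSMul ℝ E]
    {s : Set E} (hs : IsCompact s) : IsCompact (convexHull ℝ s) := by
  let comb (k : ℕ) (wz : (Fin k → ℝ) × (Fin k → E)) : E := ∑ i, wz.1 i • wz.2 i
  have hunion : convexHull ℝ s = ⋃ k ∈ Set.Iic (Module.finrank ℝ E + 1),
      comb k '' (stdSimplex ℝ (Fin k) ×ˢ Set.univ.pi fun _ => s) := by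
    ext x
    simp only [Set.mem_iUnion, Set.mem_image, Prod.exists, Set.mem_prod, Set.mem_univ_pi]
    constructor
    · intro hx
      obtain ⟨ι, _, z, w, hz, hind, hw, hw1, rfl⟩ := eq_pos_convex_span_of_mem_convexHull hx
      let e := Fintype.equivFin ι
      refine ⟨_, hind.card_le_finrank_succ.trans ?_, w ∘ e.symm, z ∘ e.symm,
        ⟨⟨fun i => (hw _).le, ?_⟩, fun i => hz ⟨_, rfl⟩⟩, ?_⟩
      · exact Nat.succ_le_succ (Submodule.finrank_le _)
      · rw [← hw1]
        exact e.symm.sum_comp w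
      · exact e.symm.sum_comp fun i => w i • z i
    · rintro ⟨k, -, w, z, ⟨hw, hz⟩, rfl⟩
      exact mem_convexHull_of_exists_fintype w z hw.1 hw.2 hz rfl
  rw [hunion]
  refine (Set.finite_Iic _).isCompact_biUnion fun k _ => IsCompact.image ?_ (by fun_prop)
  exact (isCompact_stdSimplex ℝ (Fin k)).prod (isCompact_univ_pi fun _ => hs)

variable {ι : Type*}

/-- The values of `∑ q, φ (v q)` over all finite decompositions `b = ∑ q, v q` of `b` into elements
of `C`. Both `ghValues` and `starValues` are of this form, for a cone `C` and with `φ (v q)` the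
contribution of the value `q` to `I(Q;S)`. -/
def decompositionValues (C : Set (ι → ℝ)) (φ : (ι → ℝ) → ℝ) (b : ι → ℝ) : Set ℝ :=
  {r | ∃ (k : ℕ) (v : Fin k → ι → ℝ), (∀ q, v q ∈ C) ∧ ∑ q, v q = b ∧ r = ∑ q, φ (v q)}

variable {C : Set (ι → ℝ)} {φ : (ι → ℝ) → ℝ} {b : ι → ℝ}

theorem sum_mem_decompositionValues {κ : Type*} [Fintype κ] {v : κ → ι → ℝ} (hv : ∀ q, v q ∈ C)
    (hvb : ∑ q, v q = b) : ∑ q, φ (v q) ∈ decompositionValues C φ b := by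
  let e := Fintype.equivFin κ
  refine ⟨_, v ∘ e.symm, fun q => hv _, hvb ▸ e.symm.sum_comp v, ?_⟩
  exact (e.symm.sum_comp fun q => φ (v q)).symm

theorem exists_smul_eq_of_mem [Fintype ι] (hC : ∀ v ∈ C, ∀ i, 0 ≤ v i)
    (hsmul : ∀ t : ℝ, 0 ≤ t → ∀ v ∈ C, t • v ∈ C) (hb : b ∈ C) (hb0 : b ≠ 0) {v : ι → ℝ}
    (hv : v ∈ C) :
    ∃ z ∈ C, ∑ i, z i = ∑ i, b i ∧ ((∑ i, v i) / ∑ i, b i) • z = v := by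
  have hsum_b : ∑ i, b i ≠ 0 := fun h =>
    hb0 ((Fintype.sum_eq_zero_iff_of_nonneg (hC b hb)).1 h)
  rcases eq_or_ne (∑ i, v i) 0 with h | h
  · have hv0 : v = 0 := (Fintype.sum_eq_zero_iff_of_nonneg (hC v hv)).1 h
    exact ⟨b, hb, rfl, by simp [hv0]⟩
  · refine ⟨((∑ i, b i) / ∑ i, v i) • v, hsmul _ (div_nonneg ?_ ?_) v hv, ?_, ?_⟩
    · exact Finset.sum_nonneg fun i _ => hC b hb i
    · exact Finset.sum_nonneg fun i _ => hC v hv i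
    · simp only [Pi.smul_apply, smul_eq_mul, ← Finset.mul_sum]
      exact div_mul_cancel₀ _ h
    · rw [smul_smul, div_mul_div_cancel₀ hsum_b, div_self h, one_smul]

/-- By homogeneity the terms of a decomposition may be rescaled to the total mass of `b`, so that
the decomposition becomes a convex combination. -/
theorem decompositionValues_eq_setOf_mem_convexHull [Fintype ι] (hC : ∀ v ∈ C, ∀ i, 0 ≤ v i)
    (hsmul : ∀ t : ℝ, 0 ≤ t → ∀ v ∈ C, t • v ∈ C) (hφ : ∀ t v, φ (t • v) = t * φ v) (hb : b ∈ C)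
    (hb0 : b ≠ 0) :
    decompositionValues C φ b =
      {r | (b, r) ∈ convexHull ℝ ((fun v => (v, φ v)) '' {v ∈ C | ∑ i, v i = ∑ i, b i})} := by
  ext r
  constructor
  · rintro ⟨k, v, hv, hvb, rfl⟩
    let t (q : Fin k) : ℝ := (∑ i, v q i) / ∑ i, b i
    have ht : ∀ q, 0 ≤ t q := fun q => div_nonneg (Finset.sum_nonneg fun i _ => hC _ (hv q) i)
      (Finset.sum_nonneg fun i _ => hC b hb i)
    have hsum_t : ∑ q, t q = 1 := by
      have : ∑ q, ∑ i, v q i = ∑ i, b i := by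
        rw [Finset.sum_comm, ← hvb]
        simp only [Finset.sum_apply]
      rw [← Finset.sum_div, this, div_self fun h =>
        hb0 ((Fintype.sum_eq_zero_iff_of_nonneg (hC b hb)).1 h)]
    choose z hzC hzsum hz using fun q => exists_smul_eq_of_mem hC hsmul hb hb0 (hv q)
    have hz_t : ∀ q, t q • z q = v q := hz
    refine mem_convexHull_of_exists_fintype t (fun q => (z q, φ (z q))) ht hsum_t
      (fun q => ⟨z q, ⟨hzC q, hzsum q⟩, rfl⟩) ?_
    simp only [Prod.smul_mk, smul_eq_mul, ← hφ, hz_t, ← hvb]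
    exact Prod.ext (Prod.fst_sum ..) (Prod.snd_sum ..)
  · intro hr
    obtain ⟨κ, _, w, z, hw, -, hz, hsum⟩ := mem_convexHull_iff_exists_fintype.1 hr
    choose v hv hvz using hz
    have hfst : ∑ q, w q • v q = b := by
      simpa only [← hvz, Prod.fst_sum, Prod.smul_fst] using congrArg Prod.fst hsum
    have hsnd : ∑ q, φ (w q • v q) = r := by
      simpa only [← hvz, Prod.snd_sum, Prod.smul_snd, smul_eq_mul, ← hφ] using
        congrArg Prod.snd hsum
    rw [← hsnd]
    exact sum_mem_decompositionValues (fun q => hsmul _ (hw q) _ (hv q).1) hfst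

theorem isGreatest_sSup_decompositionValues [Finite ι] (hC : ∀ v ∈ C, ∀ i, 0 ≤ v i)
    (hclosed : IsClosed C) (hsmul : ∀ t : ℝ, 0 ≤ t → ∀ v ∈ C, t • v ∈ C)
    (hφ : ∀ t v, φ (t • v) = t * φ v) (hφc : Continuous φ) (hb : b ∈ C) (hb0 : b ≠ 0) :
    IsGreatest (decompositionValues C φ b) (sSup (decompositionValues C φ b)) := by
  have := Fintype.ofFinite ι
  have hslice : IsCompact {v ∈ C | ∑ i, v i = ∑ i, b i} := by
    refine (isCompact_Icc (a := (0 : ι → ℝ)) (b := fun _ => ∑ i, b i)).of_isClosed_subset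
      (hclosed.inter (isClosed_eq (by fun_prop) continuous_const)) ?_
    rintro v ⟨hv, hsum⟩
    exact ⟨hC v hv, fun i => hsum ▸
      Finset.single_le_sum (fun i _ => hC v hv i) (Finset.mem_univ i)⟩
  have hhull : IsCompact
      (convexHull ℝ ((fun v => (v, φ v)) '' {v ∈ C | ∑ i, v i = ∑ i, b i})) :=
    isCompact_convexHull_of_finiteDimensional (hslice.image (by fun_prop))
  have hcompact : IsCompact (decompositionValues C φ b) := by
    rw [decompositionValues_eq_setOf_mem_convexHull hC hsmul hφ hb hb0]
    convert (hhull.inter_right (isClosed_singleton.preimage continuous_fst (t := {b}))).image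
      continuous_snd using 1
    ext r
    simp
  exact hcompact.isGreatest_sSup
    ⟨_, sum_mem_decompositionValues (κ := Unit) (fun _ => hb) (Fintype.sum_unique _)⟩

end Decomposition

section Channel

variable {S S₁ S₂ Y Y₁ Y₂ Q Q₁ Q₂ ι : Type*} [Fintype ι]

theorem kron_mem_stdSimplex [Fintype Q₁] [Fintype Q₂] {l₁ : Y₁ → Q₁ → ℝ} {l₂ : Y₂ → Q₂ → ℝ}
    (h₁ : ∀ y, l₁ y ∈ stdSimplex ℝ Q₁) (h₂ : ∀ y, l₂ y ∈ stdSimplex ℝ Q₂) (y : Y₁ × Y₂) :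
    kron l₁ l₂ y ∈ stdSimplex ℝ (Q₁ × Q₂) :=
  ⟨fun q => mul_nonneg ((h₁ _).1 q.1) ((h₂ _).1 q.2), by
    simp only [kron, sum_prod_mul (l₁ y.1) (l₂ y.2), (h₁ _).2, (h₂ _).2, mul_one]⟩

/-- The channel that applies the channel `l i` with probability `w i`. -/
def mixture (w : ι → ℝ) (l : ι → Y → Q → ℝ) (y : Y) (q : Q) : ℝ := ∑ i, w i * l i y q

theorem mixture_mem_stdSimplex [Fintype Q] {w : ι → ℝ} {l : ι → Y → Q → ℝ}
    (hw : w ∈ stdSimplex ℝ ι) (hl : ∀ i y, l i y ∈ stdSimplex ℝ Q) (y : Y) :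
    mixture w l y ∈ stdSimplex ℝ Q := by
  have hmem := (convex_stdSimplex ℝ Q).sum_mem (t := Finset.univ) (fun i _ => hw.1 i) hw.2
    fun i _ => hl i y
  have heq : mixture w l y = ∑ i, w i • l i y := by
    ext q
    simp only [mixture, Finset.sum_apply, Pi.smul_apply, smul_eq_mul]
  rwa [heq]

variable [Fintype Y] [Fintype Y₁] [Fintype Y₂]

/-- The joint law of `Q` and `S` when `Q` is the output of the channel `l`, with transition
probabilities `l y q`, applied to the second of two variables with joint law `m`. -/
def channelLaw (m : S → Y → ℝ) (l : Y → Q → ℝ) (q : Q) (s : S) : ℝ := ∑ y, m s y * l y q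

theorem channelLaw_nonneg [Fintype Q] {m : S → Y → ℝ} {l : Y → Q → ℝ} (hm : ∀ s y, 0 ≤ m s y)
    (hl : ∀ y, l y ∈ stdSimplex ℝ Q) (q : Q) (s : S) : 0 ≤ channelLaw m l q s :=
  Finset.sum_nonneg fun y _ => mul_nonneg (hm s y) ((hl y).1 q)

theorem sum_channelLaw [Fintype Q] (m : S → Y → ℝ) {l : Y → Q → ℝ}
    (hl : ∀ y, l y ∈ stdSimplex ℝ Q) (s : S) : ∑ q, channelLaw m l q s = ∑ y, m s y := by
  simp only [channelLaw]
  rw [Finset.sum_comm]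
  simp only [← Finset.mul_sum, (hl _).2, mul_one]

theorem IsJointLaw.channelLaw [Fintype S] [Fintype Q] {m : S → Y → ℝ} {l : Y → Q → ℝ}
    (hm : IsJointLaw m) (hl : ∀ y, l y ∈ stdSimplex ℝ Q) : IsJointLaw (channelLaw m l) where
  nonneg := channelLaw_nonneg hm.nonneg hl
  sum_eq_one := by
    rw [Finset.sum_comm, ← hm.sum_eq_one]
    simp only [sum_channelLaw m hl]

theorem IsJointLaw.sum_mem_stdSimplex [Fintype S] {m : S → Y → ℝ} (hm : IsJointLaw m) :
    (fun y => ∑ s, m s y) ∈ stdSimplex ℝ Y :=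
  ⟨fun y => Finset.sum_nonneg fun s _ => hm.nonneg s y, Finset.sum_comm.trans hm.sum_eq_one⟩

theorem div_sum_mem_stdSimplex {x : Y → ℝ} (hx : ∀ y, 0 ≤ x y) (h : ∑ y, x y ≠ 0) :
    (fun y => x y / ∑ y', x y') ∈ stdSimplex ℝ Y :=
  ⟨fun y => div_nonneg (hx y) (Finset.sum_nonneg fun y' _ => hx y'), by
    rw [← Finset.sum_div, div_self h]⟩

theorem channelLaw_kron (m₁ : S₁ → Y₁ → ℝ) (m₂ : S₂ → Y₂ → ℝ) (l₁ : Y₁ → Q₁ → ℝ)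
    (l₂ : Y₂ → Q₂ → ℝ) :
    channelLaw (kron m₁ m₂) (kron l₁ l₂) = kron (channelLaw m₁ l₁) (channelLaw m₂ l₂) := by
  ext q s
  simp only [channelLaw, kron]
  rw [← sum_prod_mul (fun y => m₁ s.1 y * l₁ y q.1) fun y => m₂ s.2 y * l₂ y q.2]
  exact Finset.sum_congr rfl fun y _ => mul_mul_mul_comm _ _ _ _

theorem channelLaw_mixture (m : S → Y → ℝ) (w : ι → ℝ) (l : ι → Y → Q → ℝ) :
    channelLaw m (mixture w l) = fun q s => ∑ i, w i * channelLaw m (l i) q s := by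
  ext q s
  simp only [channelLaw, mixture, Finset.mul_sum]
  rw [Finset.sum_comm]
  simp only [mul_left_comm]

theorem mutualInfo_channelLaw_mixture_le [Fintype S] [Fintype Q] {m : S → Y → ℝ} {w : ι → ℝ}
    {l : ι → Y → Q → ℝ} (hm : ∀ s y, 0 ≤ m s y) (hw : w ∈ stdSimplex ℝ ι)
    (hl : ∀ i y, l i y ∈ stdSimplex ℝ Q) :
    mutualInfo (channelLaw m (mixture w l)) ≤ ∑ i, w i * mutualInfo (channelLaw m (l i)) := by
  rw [channelLaw_mixture]
  exact mutualInfo_sum_mul_le hw (fun i => channelLaw_nonneg hm (hl i))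
    fun i => sum_channelLaw m (hl i)

theorem sum_channelLaw_kron [Fintype S₂] (m₁ : S₁ → Y₁ → ℝ) (m₂ : S₂ → Y₂ → ℝ)
    (l : Y₁ × Y₂ → Q → ℝ) (q : Q) (s₁ : S₁) :
    ∑ s₂, channelLaw (kron m₁ m₂) l q (s₁, s₂)
      = channelLaw m₁ (mixture (fun y₂ => ∑ s₂, m₂ s₂ y₂) fun y₂ y₁ => l (y₁, y₂)) q s₁ := by
  simp only [channelLaw, mixture, kron]
  rw [Finset.sum_comm, Fintype.sum_prod_type]
  simp only [Finset.mul_sum, Finset.sum_mul, mul_assoc]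

theorem channelLaw_kron_div (m₁ : S₁ → Y₁ → ℝ) (m₂ : S₂ → Y₂ → ℝ) (l : Y₁ × Y₂ → Q → ℝ) (q : Q)
    (s₁ : S₁) (s₂ : S₂) (c : ℝ) :
    channelLaw (kron m₁ m₂) l q (s₁, s₂) / c
      = channelLaw m₂ (mixture (fun y₁ => m₁ s₁ y₁ / c) fun y₁ y₂ => l (y₁, y₂)) q s₂ := by
  simp only [channelLaw, mixture, kron, Finset.mul_sum, Finset.sum_div]
  rw [Fintype.sum_prod_type, Finset.sum_comm]
  exact Finset.sum_congr rfl fun y₂ _ => Finset.sum_congr rfl fun y₁ _ => by ring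

theorem mutualInfo_channelLaw_kron_le [Fintype S₁] [Fintype S₂] [Fintype Q] {m₁ : S₁ → Y₁ → ℝ}
    {m₂ : S₂ → Y₂ → ℝ} {l : Y₁ × Y₂ → Q → ℝ} {c₁ c₂ : ℝ} (hm₁ : IsJointLaw m₁)
    (hm₂ : IsJointLaw m₂) (hl : ∀ y, l y ∈ stdSimplex ℝ Q)
    (h₁ : mutualInfo (channelLaw m₁
      (mixture (fun y₂ => ∑ s₂, m₂ s₂ y₂) fun y₂ y₁ => l (y₁, y₂))) ≤ c₁)
    (h₂ : ∀ s₁, ∑ y₁, m₁ s₁ y₁ ≠ 0 → mutualInfo (channelLaw m₂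
      (mixture (fun y₁ => m₁ s₁ y₁ / ∑ y₁', m₁ s₁ y₁') fun y₁ y₂ => l (y₁, y₂))) ≤ c₂) :
    mutualInfo (channelLaw (kron m₁ m₂) l) ≤ c₁ + c₂ := by
  have hlaw : IsJointLaw (channelLaw (kron m₁ m₂) l) := (hm₁.kron hm₂).channelLaw hl
  have hmarg : ∀ s₁, ∑ q, ∑ s₂, channelLaw (kron m₁ m₂) l q (s₁, s₂) = ∑ y₁, m₁ s₁ y₁ := by
    intro s₁
    have hmix : ∀ y₁, mixture (fun y₂ => ∑ s₂, m₂ s₂ y₂) (fun y₂ y₁ => l (y₁, y₂)) y₁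
        ∈ stdSimplex ℝ Q := mixture_mem_stdSimplex hm₂.sum_mem_stdSimplex fun _ _ => hl _
    simp only [sum_channelLaw_kron, sum_channelLaw m₁ hmix]
  refine mutualInfo_prod_le_add hlaw.nonneg hlaw.sum_eq_one ?_ fun s₁ hs₁ => ?_
  · simpa only [sum_channelLaw_kron] using h₁
  · rw [hmarg] at hs₁
    simp only [hmarg, channelLaw_kron_div]
    exact h₂ s₁ hs₁

end Channel

section SharedInfo

variable {S Y Z κ : Type*} [Fintype κ] {P : S × Y × Z → ℝ}

section

variable [Fintype Z]

theorem margSY_nonneg (hP : ∀ t, 0 ≤ P t) (s : S) (y : Y) : 0 ≤ margSY P s y :=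
  Finset.sum_nonneg fun z _ => hP (s, y, z)

theorem margSY_smul (t : ℝ) (v : S × Y × Z → ℝ) : margSY (t • v) = t • margSY v := by
  ext s y
  simp only [margSY, Pi.smul_apply, smul_eq_mul, Finset.mul_sum]

theorem sum_margSY_apply (v : κ → S × Y × Z → ℝ) : ∑ q, margSY (v q) = margSY (∑ q, v q) := by
  ext s y
  simp only [margSY, Finset.sum_apply]
  exact Finset.sum_comm

end

section

variable [Fintype Y]

theorem margSZ_nonneg (hP : ∀ t, 0 ≤ P t) (s : S) (z : Z) : 0 ≤ margSZ P s z :=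
  Finset.sum_nonneg fun y _ => hP (s, y, z)

theorem margSZ_smul (t : ℝ) (v : S × Y × Z → ℝ) : margSZ (t • v) = t • margSZ v := by
  ext s z
  simp only [margSZ, Pi.smul_apply, smul_eq_mul, Finset.mul_sum]

theorem sum_margSZ_apply (v : κ → S × Y × Z → ℝ) : ∑ q, margSZ (v q) = margSZ (∑ q, v q) := by
  ext s y
  simp only [margSZ, Finset.sum_apply]
  exact Finset.sum_comm

end

variable [Fintype Y] [Fintype Z]

/-- The law of `S`. -/
def margS (P : S × Y × Z → ℝ) (s : S) : ℝ := ∑ y, ∑ z, P (s, y, z)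

theorem sum_margSY (P : S × Y × Z → ℝ) (s : S) : ∑ y, margSY P s y = margS P s := rfl

theorem sum_margSZ (P : S × Y × Z → ℝ) (s : S) : ∑ z, margSZ P s z = margS P s :=
  Finset.sum_comm

theorem margS_nonneg (hP : ∀ t, 0 ≤ P t) (s : S) : 0 ≤ margS P s :=
  Finset.sum_nonneg fun y _ => margSY_nonneg hP s y

theorem sum_margS [Fintype S] (hP : P ∈ stdSimplex ℝ (S × Y × Z)) : ∑ s, margS P s = 1 := by
  rw [← hP.2]
  simp only [margS, Fintype.sum_prod_type]

theorem isJointLaw_margSY [Fintype S] (hP : P ∈ stdSimplex ℝ (S × Y × Z)) :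
    IsJointLaw (margSY P) where
  nonneg := margSY_nonneg hP.1
  sum_eq_one := by simp only [sum_margSY, sum_margS hP]

theorem isJointLaw_margSZ [Fintype S] (hP : P ∈ stdSimplex ℝ (S × Y × Z)) :
    IsJointLaw (margSZ P) where
  nonneg := margSZ_nonneg hP.1
  sum_eq_one := by simp only [sum_margSZ, sum_margS hP]

theorem margS_smul (t : ℝ) (v : S × Y × Z → ℝ) : margS (t • v) = t • margS v := by
  ext s
  simp only [margS, Pi.smul_apply, smul_eq_mul, Finset.mul_sum]

theorem sum_margS_apply (v : κ → S × Y × Z → ℝ) (s : S) :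
    ∑ q, margS (v q) s = margS (∑ q, v q) s := by
  simp only [← sum_margSY, ← sum_margSY_apply, Finset.sum_apply]
  exact Finset.sum_comm

theorem isJointLaw_margS_apply [Fintype S] {v : κ → S × Y × Z → ℝ}
    (hP : P ∈ stdSimplex ℝ (S × Y × Z)) (hv : ∀ q t, 0 ≤ v q t) (hsum : ∑ q, v q = P) :
    IsJointLaw fun q => margS (v q) where
  nonneg q := margS_nonneg (hv q)
  sum_eq_one := by
    rw [Finset.sum_comm]
    simp only [sum_margS_apply, hsum, sum_margS hP]

end SharedInfo

section Wedge

variable {S Y Z Q : Type*} [DecidableEq Q]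

/-- The channel that outputs `f y` on input `y`. -/
def detChannel (f : Y → Q) (y : Y) (q : Q) : ℝ := if f y = q then 1 else 0

theorem detChannel_mem_stdSimplex [Fintype Q] (f : Y → Q) (y : Y) :
    detChannel f y ∈ stdSimplex ℝ Q :=
  ite_eq_mem_stdSimplex ℝ (f y)

variable [Fintype Y] [Fintype Z] [Fintype S] {P : S × Y × Z → ℝ}

theorem mem_wedgeValues_iff {r : ℝ} : r ∈ wedgeValues P ↔
    ∃ (k : ℕ) (f : Y → Fin k) (f' : Z → Fin k), (∀ s y z, P (s, y, z) ≠ 0 → f y = f' z) ∧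
      r = mutualInfo (channelLaw (margSY P) (detChannel f)) := by
  have hlaw : ∀ {k : ℕ} (f : Y → Fin k),
      (fun q s => ∑ y, ∑ z, if f y = q then P (s, y, z) else 0)
        = channelLaw (margSY P) (detChannel f) := fun f => by
    ext q s
    simp only [channelLaw, margSY, detChannel, mul_ite, mul_one, mul_zero]
    refine Finset.sum_congr rfl fun y _ => ?_
    split_ifs <;> simp
  simp only [wedgeValues, Set.mem_ofPred_eq, hlaw]

theorem mutualInfo_detChannel_comp_of_injective [Fintype Q] {Q' : Type*} [Fintype Q']
    [DecidableEq Q'] (m : S → Y → ℝ) {g : Q' → Q} (hg : Function.Injective g) (f : Y → Q') :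
    mutualInfo (channelLaw m (detChannel f))
      = mutualInfo (channelLaw m (detChannel (g ∘ f))) := by
  rw [← mutualInfo_comp_of_injective hg]
  · congr 1
    ext q s
    simp only [channelLaw, detChannel, Function.comp_apply, hg.eq_iff]
  · intro q hq
    ext s
    exact Finset.sum_eq_zero fun y _ => mul_eq_zero_of_right _ (if_neg fun h => hq ⟨f y, h⟩)

theorem mutualInfo_mem_wedgeValues [Fintype Q] {f : Y → Q} {f' : Z → Q}
    (h : ∀ s y z, P (s, y, z) ≠ 0 → f y = f' z) :
    mutualInfo (channelLaw (margSY P) (detChannel f)) ∈ wedgeValues P := by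
  let e := Fintype.equivFin Q
  exact mem_wedgeValues_iff.2 ⟨_, e ∘ f, e ∘ f', fun s y z hP => congrArg e (h s y z hP),
    mutualInfo_detChannel_comp_of_injective _ e.injective f⟩

/-- `I(f(Y);S)` depends only on the partition of the state space of `Y` into the fibres of `f`. -/
theorem finite_wedgeValues (P : S × Y × Z → ℝ) : (wedgeValues P).Finite := by
  classical
  have : Finite (Setoid Y) :=
    Finite.of_injective (fun σ : Setoid Y => fun a b => σ a b) fun σ τ h => Setoid.ext fun a b =>
      iff_of_eq (congrFun (congrFun h a) b)
  refine (Set.finite_range fun σ : Setoid Y =>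
    mutualInfo (channelLaw (margSY P) (detChannel (Quotient.mk σ)))).subset ?_
  intro r hr
  obtain ⟨k, f, f', -, rfl⟩ := mem_wedgeValues_iff.1 hr
  exact ⟨Setoid.ker f,
    mutualInfo_detChannel_comp_of_injective _ (Setoid.kerLift_injective f) (Quotient.mk _)⟩

theorem isGreatest_sSup_wedgeValues (P : S × Y × Z → ℝ) :
    IsGreatest (wedgeValues P) (sSup (wedgeValues P)) :=
  (finite_wedgeValues P).isCompact.isGreatest_sSup
    ⟨_, mutualInfo_mem_wedgeValues (Q := Unit) (f' := fun _ => ()) fun _ _ _ _ => rfl⟩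

end Wedge

section GH

variable {S S₁ S₂ Y Y₁ Y₂ Z κ : Type*}

/-- The arrays obtained from `m` by multiplying each column `m · y` by some factor. When `m` is the
law of `(S,Y)`, the nonnegative ones are, up to scaling, the restrictions of this law to events
that are conditionally independent of `S` given `Y`. -/
def columnScalings (m : S → Y → ℝ) : Submodule ℝ (S → Y → ℝ) where
  carrier := {r | ∃ l : Y → ℝ, ∀ s y, r s y = m s y * l y}
  zero_mem' := ⟨0, fun _ _ => (mul_zero _).symm⟩
  add_mem' := by
    rintro _ _ ⟨l, hl⟩ ⟨l', hl'⟩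
    exact ⟨l + l', fun s y => by simp only [Pi.add_apply, hl, hl', mul_add]⟩
  smul_mem' := by
    rintro t _ ⟨l, hl⟩
    exact ⟨t • l, fun s y => by simp only [Pi.smul_apply, smul_eq_mul, hl, mul_left_comm]⟩

theorem mem_columnScalings {m r : S → Y → ℝ} :
    r ∈ columnScalings m ↔ ∃ l : Y → ℝ, ∀ s y, r s y = m s y * l y :=
  Iff.rfl

theorem self_mem_columnScalings (m : S → Y → ℝ) : m ∈ columnScalings m :=
  mem_columnScalings.2 ⟨1, fun _ _ => (mul_one _).symm⟩

theorem kron_mem_columnScalings {m₁ r₁ : S₁ → Y₁ → ℝ} {m₂ r₂ : S₂ → Y₂ → ℝ}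
    (h₁ : r₁ ∈ columnScalings m₁) (h₂ : r₂ ∈ columnScalings m₂) :
    kron r₁ r₂ ∈ columnScalings (kron m₁ m₂) := by
  obtain ⟨l₁, hl₁⟩ := mem_columnScalings.1 h₁
  obtain ⟨l₂, hl₂⟩ := mem_columnScalings.1 h₂
  refine mem_columnScalings.2 ⟨fun y => l₁ y.1 * l₂ y.2, fun s y => ?_⟩
  simp only [kron, hl₁, hl₂, mul_mul_mul_comm]

theorem sum_snd_mem_columnScalings [Fintype S₂] [Fintype Y₂] {m₁ : S₁ → Y₁ → ℝ} {m₂ : S₂ → Y₂ → ℝ}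
    {r : S₁ × S₂ → Y₁ × Y₂ → ℝ} (hr : r ∈ columnScalings (kron m₁ m₂)) :
    (fun s₁ y₁ => ∑ s₂, ∑ y₂, r (s₁, s₂) (y₁, y₂)) ∈ columnScalings m₁ := by
  obtain ⟨l, hl⟩ := mem_columnScalings.1 hr
  refine mem_columnScalings.2 ⟨fun y₁ => ∑ s₂, ∑ y₂, m₂ s₂ y₂ * l (y₁, y₂), fun s₁ y₁ => ?_⟩
  simp only [hl, kron, Finset.mul_sum, mul_assoc]

theorem sum_fst_mem_columnScalings [Fintype Y₁] {m₁ : S₁ → Y₁ → ℝ} {m₂ : S₂ → Y₂ → ℝ}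
    {r : S₁ × S₂ → Y₁ × Y₂ → ℝ} (hr : r ∈ columnScalings (kron m₁ m₂)) (s₁ : S₁) :
    (fun s₂ y₂ => ∑ y₁, r (s₁, s₂) (y₁, y₂)) ∈ columnScalings m₂ := by
  obtain ⟨l, hl⟩ := mem_columnScalings.1 hr
  refine mem_columnScalings.2 ⟨fun y₂ => ∑ y₁, m₁ s₁ y₁ * l (y₁, y₂), fun s₂ y₂ => ?_⟩
  simp only [hl, kron, Finset.mul_sum, mul_assoc, mul_left_comm]

section MarkovCone

variable [Fintype Y] [Fintype Z] {P : S × Y × Z → ℝ}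

/-- The nonnegative functions on `S × Y × Z` that can occur, up to scaling, as `R (·, q)`, for `R`
an extension of `P` by a variable `Q` with `I(S;Q|Y) = I(S;Q|Z) = 0`. -/
def markovCone (P : S × Y × Z → ℝ) : Set (S × Y × Z → ℝ) :=
  {v | (∀ t, 0 ≤ v t) ∧ margSY v ∈ columnScalings (margSY P) ∧
    margSZ v ∈ columnScalings (margSZ P)}

theorem smul_mem_markovCone {t : ℝ} (ht : 0 ≤ t) {v : S × Y × Z → ℝ} (hv : v ∈ markovCone P) :
    t • v ∈ markovCone P := by
  refine ⟨fun i => mul_nonneg ht (hv.1 i), ?_, ?_⟩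
  · rw [margSY_smul]
    exact Submodule.smul_mem _ t hv.2.1
  · rw [margSZ_smul]
    exact Submodule.smul_mem _ t hv.2.2

theorem self_mem_markovCone (hP : ∀ t, 0 ≤ P t) : P ∈ markovCone P :=
  ⟨hP, self_mem_columnScalings _, self_mem_columnScalings _⟩

theorem isClosed_markovCone [Finite S] (P : S × Y × Z → ℝ) : IsClosed (markovCone P) := by
  have hSY : Continuous (margSY : (S × Y × Z → ℝ) → S → Y → ℝ) := by
    unfold margSY
    fun_prop
  have hSZ : Continuous (margSZ : (S × Y × Z → ℝ) → S → Z → ℝ) := by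
    unfold margSZ
    fun_prop
  exact isClosed_Ici.inter
    (((columnScalings (margSY P)).closed_of_finiteDimensional.preimage hSY).inter
      ((columnScalings (margSZ P)).closed_of_finiteDimensional.preimage hSZ))

end MarkovCone

variable [Fintype S] [Fintype Y] [Fintype κ]

theorem condMutualInfo_eq_zero_iff_mem_columnScalings {m : κ → S → Y → ℝ}
    (hm : ∀ q s y, 0 ≤ m q s y) :
    condMutualInfo (fun s q y => m q s y) = 0 ↔ ∀ q, m q ∈ columnScalings (∑ q', m q') := by
  simp only [condMutualInfo_eq_zero_iff fun s q y => hm q s y, mem_columnScalings,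
    Finset.sum_apply, Classical.skolem]
  exact exists_congr fun l => forall_comm

variable [Fintype Z] {P : S × Y × Z → ℝ}

theorem mem_markovCone_iff_condMutualInfo_eq_zero {v : κ → S × Y × Z → ℝ}
    (hv : ∀ q t, 0 ≤ v q t) (hsum : ∑ q, v q = P) :
    (∀ q, v q ∈ markovCone P) ↔
      condMutualInfo (fun s q y => margSY (v q) s y) = 0 ∧
      condMutualInfo (fun s q z => margSZ (v q) s z) = 0 := by
  rw [condMutualInfo_eq_zero_iff_mem_columnScalings fun q => margSY_nonneg (hv q),
    condMutualInfo_eq_zero_iff_mem_columnScalings fun q => margSZ_nonneg (hv q),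
    sum_margSY_apply, sum_margSZ_apply, hsum, ← forall_and]
  exact forall_congr' fun q => and_iff_right (hv q)

theorem mem_ghValues_iff (hP : P ∈ stdSimplex ℝ (S × Y × Z)) {r : ℝ} : r ∈ ghValues P ↔
    ∃ (k : ℕ) (v : Fin k → S × Y × Z → ℝ), (∀ q, v q ∈ markovCone P) ∧ ∑ q, v q = P ∧
      r = mutualInfo (fun q => margS (v q)) := by
  constructor
  · rintro ⟨k, R, hR, hRP, hY, hZ, rfl⟩
    have hsum : ∑ q, (fun t : S × Y × Z => R (t.1, t.2.1, t.2.2, q)) = P := by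
      ext t
      simpa only [Finset.sum_apply] using hRP t.1 t.2.1 t.2.2
    exact ⟨k, fun q t => R (t.1, t.2.1, t.2.2, q),
      (mem_markovCone_iff_condMutualInfo_eq_zero (fun q t => hR.1 _) hsum).2 ⟨hY, hZ⟩, hsum, rfl⟩
  · rintro ⟨k, v, hv, hsum, rfl⟩
    obtain ⟨hY, hZ⟩ := (mem_markovCone_iff_condMutualInfo_eq_zero (fun q => (hv q).1) hsum).1 hv
    have hsum_apply : ∀ t, ∑ q, v q t = P t := fun t => by rw [← hsum, Finset.sum_apply]
    refine ⟨k, fun t => v t.2.2.2 (t.1, t.2.1, t.2.2.1), ⟨fun t => (hv _).1 _, ?_⟩,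
      fun s y z => hsum_apply (s, y, z), hY, hZ, rfl⟩
    simpa only [Fintype.sum_prod_type, hsum_apply] using hP.2

theorem mutualInfo_margS_eq_sum_pointwiseInfo {v : κ → S × Y × Z → ℝ} (hv : ∀ q t, 0 ≤ v q t)
    (hsum : ∑ q, v q = P) :
    mutualInfo (fun q => margS (v q)) = ∑ q, pointwiseInfo (margS P) (margS (v q)) :=
  mutualInfo_eq_sum_pointwiseInfo (fun q => margS_nonneg (hv q)) fun s => by
    rw [sum_margS_apply, hsum]

theorem ghValues_eq_decompositionValues (hP : P ∈ stdSimplex ℝ (S × Y × Z)) : ghValues P =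
    decompositionValues (markovCone P) (fun v => pointwiseInfo (margS P) (margS v)) P := by
  ext r
  rw [mem_ghValues_iff hP]
  refine exists_congr fun k => exists_congr fun v => and_congr_right fun hv =>
    and_congr_right fun hsum => ?_
  rw [mutualInfo_margS_eq_sum_pointwiseInfo (fun q => (hv q).1) hsum]

theorem mutualInfo_margS_mem_ghValues (hP : P ∈ stdSimplex ℝ (S × Y × Z))
    {v : κ → S × Y × Z → ℝ} (hv : ∀ q, v q ∈ markovCone P) (hsum : ∑ q, v q = P) :
    mutualInfo (fun q => margS (v q)) ∈ ghValues P := by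
  rw [ghValues_eq_decompositionValues hP,
    mutualInfo_margS_eq_sum_pointwiseInfo (fun q => (hv q).1) hsum]
  exact sum_mem_decompositionValues hv hsum

theorem isGreatest_sSup_ghValues (hP : P ∈ stdSimplex ℝ (S × Y × Z)) :
    IsGreatest (ghValues P) (sSup (ghValues P)) := by
  have hP0 : P ≠ 0 := by
    rintro rfl
    simpa using hP.2
  have hcont : Continuous fun v : S × Y × Z → ℝ => pointwiseInfo (margS P) (margS v) := by
    refine (continuous_pointwiseInfo _).comp ?_
    unfold margS
    fun_prop
  rw [ghValues_eq_decompositionValues hP]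
  exact isGreatest_sSup_decompositionValues (fun v hv => hv.1) (isClosed_markovCone P)
    (fun t ht v hv => smul_mem_markovCone ht hv)
    (fun t v => by rw [margS_smul, pointwiseInfo_smul]) hcont (self_mem_markovCone hP.1) hP0

end GH

section Star

variable {S Y Z Q : Type*} [Fintype Y] [Fintype Z] [Fintype Q] {P : S × Y × Z → ℝ}

/-- A pair of stochastic matrices that satisfies the constraint defining `SI_∩^*`: the outputs of
`lY` applied to `Y` and of `lZ` applied to `Z` have the same joint law with `S`. -/
structure IsChannelPair (P : S × Y × Z → ℝ) (lY : Y → Q → ℝ) (lZ : Z → Q → ℝ) : Prop where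
  mem_stdSimplex_left : ∀ y, lY y ∈ stdSimplex ℝ Q
  mem_stdSimplex_right : ∀ z, lZ z ∈ stdSimplex ℝ Q
  channelLaw_eq : channelLaw (margSY P) lY = channelLaw (margSZ P) lZ

/-- The functions on `Y ⊕ Z` that can occur as `Sum.elim (l · q) (l' · q)` for a pair of channels
`l`, `l'` as in `IsChannelPair`, up to scaling. -/
def channelCone (P : S × Y × Z → ℝ) : Set (Y ⊕ Z → ℝ) :=
  {v | (∀ i, 0 ≤ v i) ∧
    ∀ s, ∑ y, margSY P s y * v (Sum.inl y) = ∑ z, margSZ P s z * v (Sum.inr z)}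

theorem isChannelPair_iff_mem_channelCone {v : Q → Y ⊕ Z → ℝ} :
    IsChannelPair P (fun y q => v q (Sum.inl y)) (fun z q => v q (Sum.inr z)) ↔
      (∀ q, v q ∈ channelCone P) ∧ ∑ q, v q = 1 := by
  constructor
  · rintro ⟨hl, hl', heq⟩
    refine ⟨fun q => ⟨?_, fun s => congrFun (congrFun heq q) s⟩, ?_⟩
    · rintro (y | z)
      exacts [(hl y).1 q, (hl' z).1 q]
    · ext (y | z) <;> rw [Finset.sum_apply]
      exacts [(hl y).2, (hl' z).2]
  · rintro ⟨hv, hsum⟩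
    have hsum_apply : ∀ i, ∑ q, v q i = 1 := fun i => by
      rw [← Finset.sum_apply, hsum, Pi.one_apply]
    exact ⟨fun y => ⟨fun q => (hv q).1 _, hsum_apply _⟩,
      fun z => ⟨fun q => (hv q).1 _, hsum_apply _⟩, funext fun q => funext fun s => (hv q).2 s⟩

theorem isClosed_channelCone (P : S × Y × Z → ℝ) : IsClosed (channelCone P) := by
  have heq : channelCone P = Set.Ici 0 ∩
      ⋂ s, {v | ∑ y, margSY P s y * v (Sum.inl y) = ∑ z, margSZ P s z * v (Sum.inr z)} := by
    ext v
    simp only [channelCone, Set.mem_ofPred_eq, Set.mem_inter_iff, Set.mem_iInter, Set.mem_Ici,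
      Pi.le_def, Pi.zero_apply]
  rw [heq]
  exact isClosed_Ici.inter
    (isClosed_iInter fun s => isClosed_eq (by fun_prop) (by fun_prop))

theorem smul_mem_channelCone {t : ℝ} (ht : 0 ≤ t) {v : Y ⊕ Z → ℝ} (hv : v ∈ channelCone P) :
    t • v ∈ channelCone P := by
  refine ⟨fun i => mul_nonneg ht (hv.1 i), fun s => ?_⟩
  simp only [Pi.smul_apply, smul_eq_mul, mul_left_comm _ t, ← Finset.mul_sum, hv.2 s]

theorem one_mem_channelCone (P : S × Y × Z → ℝ) : 1 ∈ channelCone P :=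
  ⟨fun _ => zero_le_one, fun s => by
    simp only [Pi.one_apply, mul_one, sum_margSY, sum_margSZ]⟩

variable [Fintype S]

theorem mem_starValues_iff {r : ℝ} : r ∈ starValues P ↔
    ∃ (k : ℕ) (l : Y → Fin k → ℝ) (l' : Z → Fin k → ℝ), IsChannelPair P l l' ∧
      r = mutualInfo (channelLaw (margSY P) l) := by
  refine exists_congr fun k => exists_congr fun l => exists_congr fun l' => ?_
  constructor
  · rintro ⟨hl, hl', heq, hr⟩
    exact ⟨⟨hl, hl', funext fun q => funext fun s => heq s q⟩, hr⟩
  · rintro ⟨⟨hl, hl', heq⟩, hr⟩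
    exact ⟨hl, hl', fun s q => congrFun (congrFun heq q) s, hr⟩

theorem IsChannelPair.mutualInfo_eq_sum_pointwiseInfo {l : Y → Q → ℝ} {l' : Z → Q → ℝ}
    (h : IsChannelPair P l l') (hP : ∀ t, 0 ≤ P t) :
    mutualInfo (channelLaw (margSY P) l)
      = ∑ q, pointwiseInfo (margS P) (channelLaw (margSY P) l q) :=
  InfoDecomp.mutualInfo_eq_sum_pointwiseInfo
    (channelLaw_nonneg (margSY_nonneg hP) h.mem_stdSimplex_left)
    (sum_channelLaw _ h.mem_stdSimplex_left)

theorem starValues_eq_decompositionValues (hP : ∀ t, 0 ≤ P t) : starValues P =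
    decompositionValues (channelCone P)
      (fun v => pointwiseInfo (margS P) fun s => ∑ y, margSY P s y * v (Sum.inl y)) 1 := by
  ext r
  rw [mem_starValues_iff]
  constructor
  · rintro ⟨k, l, l', h, rfl⟩
    let v (q : Fin k) : Y ⊕ Z → ℝ := Sum.elim (fun y => l y q) fun z => l' z q
    obtain ⟨hv, hsum⟩ := isChannelPair_iff_mem_channelCone (v := v).1 h
    exact ⟨k, v, hv, hsum, h.mutualInfo_eq_sum_pointwiseInfo hP⟩
  · rintro ⟨k, v, hv, hsum, rfl⟩
    have h := isChannelPair_iff_mem_channelCone.2 ⟨hv, hsum⟩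
    exact ⟨k, _, _, h, (h.mutualInfo_eq_sum_pointwiseInfo hP).symm⟩

theorem IsChannelPair.mutualInfo_mem_starValues {l : Y → Q → ℝ} {l' : Z → Q → ℝ}
    (h : IsChannelPair P l l') (hP : ∀ t, 0 ≤ P t) :
    mutualInfo (channelLaw (margSY P) l) ∈ starValues P := by
  rw [starValues_eq_decompositionValues hP, h.mutualInfo_eq_sum_pointwiseInfo hP]
  obtain ⟨hv, hsum⟩ := isChannelPair_iff_mem_channelCone
    (v := fun q => Sum.elim (fun y => l y q) fun z => l' z q).1 h
  have hmem := sum_mem_decompositionValues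
    (φ := fun v => pointwiseInfo (margS P) fun s => ∑ y, margSY P s y * v (Sum.inl y)) hv hsum
  exact hmem

theorem isGreatest_sSup_starValues (hP : P ∈ stdSimplex ℝ (S × Y × Z)) :
    IsGreatest (starValues P) (sSup (starValues P)) := by
  have hY : Nonempty Y := by
    by_contra hempty
    rw [not_nonempty_iff] at hempty
    simpa using hP.2
  have hcont : Continuous fun v : Y ⊕ Z → ℝ =>
      pointwiseInfo (margS P) fun s => ∑ y, margSY P s y * v (Sum.inl y) :=
    (continuous_pointwiseInfo _).comp (by fun_prop)
  rw [starValues_eq_decompositionValues hP.1]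
  refine isGreatest_sSup_decompositionValues (fun v hv => hv.1) (isClosed_channelCone P)
    (fun t ht v hv => smul_mem_channelCone ht hv) (fun t v => ?_) hcont (one_mem_channelCone P)
    one_ne_zero
  rw [← pointwiseInfo_smul]
  simp only [Pi.smul_apply, smul_eq_mul, mul_left_comm _ t, ← Finset.mul_sum]
  rfl

end Star

section Product

variable {S₁ S₂ Y₁ Y₂ Z₁ Z₂ : Type*}

/-- The law of `(S₁S₂, Y₁Y₂, Z₁Z₂)` when the triples `(S₁, Y₁, Z₁)` and `(S₂, Y₂, Z₂)` are
independent with laws `P₁` and `P₂`. -/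
def prodLaw (P₁ : S₁ × Y₁ × Z₁ → ℝ) (P₂ : S₂ × Y₂ × Z₂ → ℝ)
    (t : (S₁ × S₂) × (Y₁ × Y₂) × Z₁ × Z₂) : ℝ :=
  P₁ (t.1.1, t.2.1.1, t.2.2.1) * P₂ (t.1.2, t.2.1.2, t.2.2.2)

theorem margSY_prodLaw [Fintype Z₁] [Fintype Z₂] (P₁ : S₁ × Y₁ × Z₁ → ℝ)
    (P₂ : S₂ × Y₂ × Z₂ → ℝ) : margSY (prodLaw P₁ P₂) = kron (margSY P₁) (margSY P₂) := by
  ext s y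
  exact sum_prod_mul (fun z => P₁ (s.1, y.1, z)) fun z => P₂ (s.2, y.2, z)

theorem margSZ_prodLaw [Fintype Y₁] [Fintype Y₂] (P₁ : S₁ × Y₁ × Z₁ → ℝ)
    (P₂ : S₂ × Y₂ × Z₂ → ℝ) : margSZ (prodLaw P₁ P₂) = kron (margSZ P₁) (margSZ P₂) := by
  ext s z
  exact sum_prod_mul (fun y => P₁ (s.1, y, z.1)) fun y => P₂ (s.2, y, z.2)

theorem detChannel_prodMap {Q₁ Q₂ : Type*} [DecidableEq Q₁] [DecidableEq Q₂] (f₁ : Y₁ → Q₁)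
    (f₂ : Y₂ → Q₂) : detChannel (Prod.map f₁ f₂) = kron (detChannel f₁) (detChannel f₂) := by
  ext y q
  simp only [detChannel, kron, Prod.map, Prod.ext_iff, ite_and, ite_mul, one_mul, zero_mul]

/-- The law of `(S₁, Y₁, Z₁)` when `R` is the law of `(S₁S₂, Y₁Y₂, Z₁Z₂)`. -/
def margFst [Fintype S₂] [Fintype Y₂] [Fintype Z₂]
    (R : (S₁ × S₂) × (Y₁ × Y₂) × Z₁ × Z₂ → ℝ) (t : S₁ × Y₁ × Z₁) : ℝ :=
  ∑ s₂, ∑ y₂, ∑ z₂, R ((t.1, s₂), (t.2.1, y₂), (t.2.2, z₂))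

/-- The law of `(S₂, Y₂, Z₂)` restricted to the event `S₁ = s₁`, and not normalised, when `R` is
the law of `(S₁S₂, Y₁Y₂, Z₁Z₂)`. -/
def restrictSnd [Fintype Y₁] [Fintype Z₁]
    (R : (S₁ × S₂) × (Y₁ × Y₂) × Z₁ × Z₂ → ℝ) (s₁ : S₁) (t : S₂ × Y₂ × Z₂) : ℝ :=
  ∑ y₁, ∑ z₁, R ((s₁, t.1), (y₁, t.2.1), (z₁, t.2.2))

theorem margSY_margFst [Fintype S₂] [Fintype Y₂] [Fintype Z₁] [Fintype Z₂]
    (R : (S₁ × S₂) × (Y₁ × Y₂) × Z₁ × Z₂ → ℝ) :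
    margSY (margFst R) = fun s₁ y₁ => ∑ s₂, ∑ y₂, margSY R (s₁, s₂) (y₁, y₂) := by
  ext s₁ y₁
  simp only [margSY, margFst, Fintype.sum_prod_type]
  rw [Finset.sum_comm]
  exact Finset.sum_congr rfl fun s₂ _ => Finset.sum_comm

theorem margSZ_margFst [Fintype S₂] [Fintype Y₁] [Fintype Y₂] [Fintype Z₂]
    (R : (S₁ × S₂) × (Y₁ × Y₂) × Z₁ × Z₂ → ℝ) :
    margSZ (margFst R) = fun s₁ z₁ => ∑ s₂, ∑ z₂, margSZ R (s₁, s₂) (z₁, z₂) := by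
  ext s₁ z₁
  simp only [margSZ, margFst, Fintype.sum_prod_type]
  rw [Finset.sum_comm]
  refine Finset.sum_congr rfl fun s₂ _ => ?_
  rw [Finset.sum_comm (s := (Finset.univ : Finset Z₂))]
  exact Finset.sum_congr rfl fun y₁ _ => Finset.sum_comm

theorem margS_margFst [Fintype S₂] [Fintype Y₁] [Fintype Y₂] [Fintype Z₁] [Fintype Z₂]
    (R : (S₁ × S₂) × (Y₁ × Y₂) × Z₁ × Z₂ → ℝ) (s₁ : S₁) :
    margS (margFst R) s₁ = ∑ s₂, margS R (s₁, s₂) := by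
  simp only [← sum_margSY, margSY_margFst, Fintype.sum_prod_type]
  exact Finset.sum_comm

theorem margSY_restrictSnd [Fintype Y₁] [Fintype Z₁] [Fintype Z₂]
    (R : (S₁ × S₂) × (Y₁ × Y₂) × Z₁ × Z₂ → ℝ) (s₁ : S₁) :
    margSY (restrictSnd R s₁) = fun s₂ y₂ => ∑ y₁, margSY R (s₁, s₂) (y₁, y₂) := by
  ext s₂ y₂
  simp only [margSY, restrictSnd, Fintype.sum_prod_type_right]
  exact Finset.sum_comm

theorem margSZ_restrictSnd [Fintype Y₁] [Fintype Y₂] [Fintype Z₁]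
    (R : (S₁ × S₂) × (Y₁ × Y₂) × Z₁ × Z₂ → ℝ) (s₁ : S₁) :
    margSZ (restrictSnd R s₁) = fun s₂ z₂ => ∑ z₁, margSZ R (s₁, s₂) (z₁, z₂) := by
  ext s₂ z₂
  simp only [margSZ, restrictSnd, Fintype.sum_prod_type_right, Finset.sum_comm (γ := Z₁)]

theorem margS_restrictSnd [Fintype Y₁] [Fintype Y₂] [Fintype Z₁] [Fintype Z₂]
    (R : (S₁ × S₂) × (Y₁ × Y₂) × Z₁ × Z₂ → ℝ) (s₁ : S₁) (s₂ : S₂) :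
    margS (restrictSnd R s₁) s₂ = margS R (s₁, s₂) := by
  simp only [← sum_margSY, margSY_restrictSnd, Fintype.sum_prod_type]
  exact Finset.sum_comm

theorem sum_margFst_apply {κ : Type*} [Fintype κ] [Fintype S₂] [Fintype Y₂] [Fintype Z₂]
    (v : κ → (S₁ × S₂) × (Y₁ × Y₂) × Z₁ × Z₂ → ℝ) :
    ∑ q, margFst (v q) = margFst (∑ q, v q) := by
  ext t
  simp only [margFst, Finset.sum_apply, Finset.sum_comm (γ := κ)]

theorem sum_restrictSnd_apply {κ : Type*} [Fintype κ] [Fintype Y₁] [Fintype Z₁]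
    (v : κ → (S₁ × S₂) × (Y₁ × Y₂) × Z₁ × Z₂ → ℝ) (s₁ : S₁) :
    ∑ q, restrictSnd (v q) s₁ = restrictSnd (∑ q, v q) s₁ := by
  ext t
  simp only [restrictSnd, Finset.sum_apply, Finset.sum_comm (γ := κ)]

theorem margFst_prodLaw [Fintype S₂] [Fintype Y₂] [Fintype Z₂]
    (P₁ : S₁ × Y₁ × Z₁ → ℝ) {P₂ : S₂ × Y₂ × Z₂ → ℝ} (h₂ : P₂ ∈ stdSimplex ℝ (S₂ × Y₂ × Z₂)) :
    margFst (prodLaw P₁ P₂) = P₁ := by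
  ext t
  simp only [margFst, prodLaw, ← Finset.mul_sum]
  rw [show ∑ s₂, ∑ y₂, ∑ z₂, P₂ (s₂, y₂, z₂) = 1 from sum_margS h₂, mul_one]

theorem restrictSnd_prodLaw [Fintype Y₁] [Fintype Z₁]
    (P₁ : S₁ × Y₁ × Z₁ → ℝ) (P₂ : S₂ × Y₂ × Z₂ → ℝ) (s₁ : S₁) :
    restrictSnd (prodLaw P₁ P₂) s₁ = margS P₁ s₁ • P₂ := by
  ext t
  simp only [restrictSnd, prodLaw, margS, ← Finset.sum_mul, Pi.smul_apply, smul_eq_mul]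

variable [Fintype Y₁] [Fintype Y₂] [Fintype Z₁] [Fintype Z₂] {P₁ : S₁ × Y₁ × Z₁ → ℝ}
  {P₂ : S₂ × Y₂ × Z₂ → ℝ}

theorem margS_prodLaw (P₁ : S₁ × Y₁ × Z₁ → ℝ) (P₂ : S₂ × Y₂ × Z₂ → ℝ) (s : S₁ × S₂) :
    margS (prodLaw P₁ P₂) s = margS P₁ s.1 * margS P₂ s.2 := by
  rw [← sum_margSY, margSY_prodLaw]
  exact sum_prod_mul (margSY P₁ s.1) (margSY P₂ s.2)

theorem prodLaw_mem_markovCone {v₁ : S₁ × Y₁ × Z₁ → ℝ} {v₂ : S₂ × Y₂ × Z₂ → ℝ}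
    (h₁ : v₁ ∈ markovCone P₁) (h₂ : v₂ ∈ markovCone P₂) :
    prodLaw v₁ v₂ ∈ markovCone (prodLaw P₁ P₂) := by
  refine ⟨fun t => mul_nonneg (h₁.1 _) (h₂.1 _), ?_, ?_⟩
  · simpa only [margSY_prodLaw] using kron_mem_columnScalings h₁.2.1 h₂.2.1
  · simpa only [margSZ_prodLaw] using kron_mem_columnScalings h₁.2.2 h₂.2.2

theorem margFst_mem_markovCone [Fintype S₂] {v : (S₁ × S₂) × (Y₁ × Y₂) × Z₁ × Z₂ → ℝ}
    (hv : v ∈ markovCone (prodLaw P₁ P₂)) : margFst v ∈ markovCone P₁ := by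
  obtain ⟨hv0, hY, hZ⟩ := hv
  rw [margSY_prodLaw] at hY
  rw [margSZ_prodLaw] at hZ
  refine ⟨fun t => Finset.sum_nonneg fun _ _ => Finset.sum_nonneg fun _ _ =>
    Finset.sum_nonneg fun _ _ => hv0 _, ?_, ?_⟩
  · rw [margSY_margFst]
    exact sum_snd_mem_columnScalings hY
  · rw [margSZ_margFst]
    exact sum_snd_mem_columnScalings hZ

theorem restrictSnd_mem_markovCone {v : (S₁ × S₂) × (Y₁ × Y₂) × Z₁ × Z₂ → ℝ}
    (hv : v ∈ markovCone (prodLaw P₁ P₂)) (s₁ : S₁) : restrictSnd v s₁ ∈ markovCone P₂ := by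
  obtain ⟨hv0, hY, hZ⟩ := hv
  rw [margSY_prodLaw] at hY
  rw [margSZ_prodLaw] at hZ
  refine ⟨fun t => Finset.sum_nonneg fun _ _ => Finset.sum_nonneg fun _ _ => hv0 _, ?_, ?_⟩
  · rw [margSY_restrictSnd]
    exact sum_fst_mem_columnScalings hY s₁
  · rw [margSZ_restrictSnd]
    exact sum_fst_mem_columnScalings hZ s₁

theorem IsChannelPair.kron {Q₁ Q₂ : Type*} [Fintype Q₁] [Fintype Q₂]
    {l₁ : Y₁ → Q₁ → ℝ} {l₁' : Z₁ → Q₁ → ℝ} {l₂ : Y₂ → Q₂ → ℝ}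
    {l₂' : Z₂ → Q₂ → ℝ} (h₁ : IsChannelPair P₁ l₁ l₁') (h₂ : IsChannelPair P₂ l₂ l₂') :
    IsChannelPair (prodLaw P₁ P₂) (kron l₁ l₂) (kron l₁' l₂') where
  mem_stdSimplex_left := kron_mem_stdSimplex h₁.mem_stdSimplex_left h₂.mem_stdSimplex_left
  mem_stdSimplex_right := kron_mem_stdSimplex h₁.mem_stdSimplex_right h₂.mem_stdSimplex_right
  channelLaw_eq := by
    rw [margSY_prodLaw, margSZ_prodLaw, channelLaw_kron, channelLaw_kron, h₁.channelLaw_eq,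
      h₂.channelLaw_eq]

variable {Q : Type*} [Fintype Q] {l : Y₁ × Y₂ → Q → ℝ} {l' : Z₁ × Z₂ → Q → ℝ}

theorem IsChannelPair.fst [Fintype S₂] (h : IsChannelPair (prodLaw P₁ P₂) l l')
    (h₂ : P₂ ∈ stdSimplex ℝ (S₂ × Y₂ × Z₂)) :
    IsChannelPair P₁ (mixture (fun y₂ => ∑ s₂, margSY P₂ s₂ y₂) fun y₂ y₁ => l (y₁, y₂))
      (mixture (fun z₂ => ∑ s₂, margSZ P₂ s₂ z₂) fun z₂ z₁ => l' (z₁, z₂)) where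
  mem_stdSimplex_left := mixture_mem_stdSimplex (isJointLaw_margSY h₂).sum_mem_stdSimplex
    fun _ _ => h.mem_stdSimplex_left _
  mem_stdSimplex_right := mixture_mem_stdSimplex (isJointLaw_margSZ h₂).sum_mem_stdSimplex
    fun _ _ => h.mem_stdSimplex_right _
  channelLaw_eq := by
    ext q s₁
    rw [← sum_channelLaw_kron, ← sum_channelLaw_kron, ← margSY_prodLaw, ← margSZ_prodLaw,
      h.channelLaw_eq]

theorem IsChannelPair.snd (h : IsChannelPair (prodLaw P₁ P₂) l l') (h₁ : ∀ t, 0 ≤ P₁ t) {s₁ : S₁}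
    (hs₁ : margS P₁ s₁ ≠ 0) :
    IsChannelPair P₂ (mixture (fun y₁ => margSY P₁ s₁ y₁ / margS P₁ s₁) fun y₁ y₂ => l (y₁, y₂))
      (mixture (fun z₁ => margSZ P₁ s₁ z₁ / margS P₁ s₁) fun z₁ z₂ => l' (z₁, z₂)) where
  mem_stdSimplex_left := mixture_mem_stdSimplex
    (div_sum_mem_stdSimplex (margSY_nonneg h₁ s₁) hs₁) fun _ _ => h.mem_stdSimplex_left _
  mem_stdSimplex_right := by
    refine mixture_mem_stdSimplex ?_ fun _ _ => h.mem_stdSimplex_right _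
    rw [← sum_margSZ] at hs₁ ⊢
    exact div_sum_mem_stdSimplex (margSZ_nonneg h₁ s₁) hs₁
  channelLaw_eq := by
    ext q s₂
    rw [← channelLaw_kron_div, ← channelLaw_kron_div, ← margSY_prodLaw, ← margSZ_prodLaw,
      h.channelLaw_eq]

variable [Fintype S₁] [Fintype S₂] {c₁ c₂ : ℝ}

theorem prodLaw_mem_stdSimplex (h₁ : P₁ ∈ stdSimplex ℝ (S₁ × Y₁ × Z₁))
    (h₂ : P₂ ∈ stdSimplex ℝ (S₂ × Y₂ × Z₂)) :
    prodLaw P₁ P₂ ∈ stdSimplex ℝ ((S₁ × S₂) × (Y₁ × Y₂) × Z₁ × Z₂) := by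
  refine ⟨fun t => mul_nonneg (h₁.1 _) (h₂.1 _), ?_⟩
  calc ∑ t, prodLaw P₁ P₂ t = ∑ s, margS (prodLaw P₁ P₂) s := by
        simp only [margS, Fintype.sum_prod_type]
    _ = 1 := by
        simp only [margS_prodLaw, sum_prod_mul (margS P₁), sum_margS h₁, sum_margS h₂, mul_one]

theorem isGreatest_starValues_prodLaw (h₁ : P₁ ∈ stdSimplex ℝ (S₁ × Y₁ × Z₁))
    (h₂ : P₂ ∈ stdSimplex ℝ (S₂ × Y₂ × Z₂)) (hc₁ : IsGreatest (starValues P₁) c₁)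
    (hc₂ : IsGreatest (starValues P₂) c₂) :
    IsGreatest (starValues (prodLaw P₁ P₂)) (c₁ + c₂) := by
  constructor
  · obtain ⟨k₁, l₁, l₁', hl₁, rfl⟩ := mem_starValues_iff.1 hc₁.1
    obtain ⟨k₂, l₂, l₂', hl₂, rfl⟩ := mem_starValues_iff.1 hc₂.1
    rw [← mutualInfo_kron ((isJointLaw_margSY h₁).channelLaw hl₁.mem_stdSimplex_left)
      ((isJointLaw_margSY h₂).channelLaw hl₂.mem_stdSimplex_left), ← channelLaw_kron,
      ← margSY_prodLaw]
    exact (hl₁.kron hl₂).mutualInfo_mem_starValues (prodLaw_mem_stdSimplex h₁ h₂).1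
  · intro r hr
    obtain ⟨k, l, l', hl, rfl⟩ := mem_starValues_iff.1 hr
    rw [margSY_prodLaw]
    exact mutualInfo_channelLaw_kron_le (isJointLaw_margSY h₁) (isJointLaw_margSY h₂)
      hl.mem_stdSimplex_left (hc₁.2 ((hl.fst h₂).mutualInfo_mem_starValues h₁.1))
      fun s₁ hs₁ => hc₂.2 ((hl.snd h₁.1 hs₁).mutualInfo_mem_starValues h₂.1)

/-- Averaging a deterministic channel over one factor of its input yields a stochastic one, hence
the appeal to convexity instead of an admissible pair of functions for each factor. -/
theorem isGreatest_wedgeValues_prodLaw (h₁ : P₁ ∈ stdSimplex ℝ (S₁ × Y₁ × Z₁))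
    (h₂ : P₂ ∈ stdSimplex ℝ (S₂ × Y₂ × Z₂)) (hc₁ : IsGreatest (wedgeValues P₁) c₁)
    (hc₂ : IsGreatest (wedgeValues P₂) c₂) :
    IsGreatest (wedgeValues (prodLaw P₁ P₂)) (c₁ + c₂) := by
  have hm₁ := isJointLaw_margSY h₁
  have hm₂ := isJointLaw_margSY h₂
  constructor
  · obtain ⟨k₁, f₁, f₁', hf₁, rfl⟩ := mem_wedgeValues_iff.1 hc₁.1
    obtain ⟨k₂, f₂, f₂', hf₂, rfl⟩ := mem_wedgeValues_iff.1 hc₂.1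
    rw [← mutualInfo_kron (hm₁.channelLaw (detChannel_mem_stdSimplex f₁))
      (hm₂.channelLaw (detChannel_mem_stdSimplex f₂)), ← channelLaw_kron, ← margSY_prodLaw,
      ← detChannel_prodMap]
    refine mutualInfo_mem_wedgeValues (f' := Prod.map f₁' f₂') fun s y z hne => ?_
    exact Prod.ext (hf₁ _ _ _ (left_ne_zero_of_mul hne)) (hf₂ _ _ _ (right_ne_zero_of_mul hne))
  · intro r hr
    obtain ⟨k, f, f', hf, rfl⟩ := mem_wedgeValues_iff.1 hr
    rw [margSY_prodLaw]
    refine mutualInfo_channelLaw_kron_le hm₁ hm₂ (detChannel_mem_stdSimplex f) ?_ fun s₁ hs₁ => ?_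
    · refine (mutualInfo_channelLaw_mixture_le hm₁.nonneg hm₂.sum_mem_stdSimplex
        fun _ _ => detChannel_mem_stdSimplex f _).trans ?_
      refine sum_mul_le_of_mem_stdSimplex hm₂.sum_mem_stdSimplex fun y₂ hy₂ => hc₁.2 ?_
      obtain ⟨s₂, -, hs₂⟩ := Finset.exists_ne_zero_of_sum_ne_zero hy₂
      obtain ⟨z₂, -, hz₂⟩ := Finset.exists_ne_zero_of_sum_ne_zero hs₂
      exact mutualInfo_mem_wedgeValues (f := fun y₁ => f (y₁, y₂)) (f' := fun z₁ => f' (z₁, z₂))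
        fun s₁ y₁ z₁ hne => hf (s₁, s₂) (y₁, y₂) (z₁, z₂) (mul_ne_zero hne hz₂)
    · have hw := div_sum_mem_stdSimplex (margSY_nonneg h₁.1 s₁) hs₁
      refine (mutualInfo_channelLaw_mixture_le hm₂.nonneg hw
        fun _ _ => detChannel_mem_stdSimplex f _).trans ?_
      refine sum_mul_le_of_mem_stdSimplex hw fun y₁ hy₁ => hc₂.2 ?_
      obtain ⟨z₁, -, hz₁⟩ := Finset.exists_ne_zero_of_sum_ne_zero (div_ne_zero_iff.1 hy₁).1
      exact mutualInfo_mem_wedgeValues (f := fun y₂ => f (y₁, y₂)) (f' := fun z₂ => f' (z₁, z₂))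
        fun s₂ y₂ z₂ hne => hf (s₁, s₂) (y₁, y₂) (z₁, z₂) (mul_ne_zero hz₁ hne)

theorem add_mem_ghValues_prodLaw (h₁ : P₁ ∈ stdSimplex ℝ (S₁ × Y₁ × Z₁))
    (h₂ : P₂ ∈ stdSimplex ℝ (S₂ × Y₂ × Z₂)) (hc₁ : c₁ ∈ ghValues P₁) (hc₂ : c₂ ∈ ghValues P₂) :
    c₁ + c₂ ∈ ghValues (prodLaw P₁ P₂) := by
  obtain ⟨k₁, v₁, hv₁, hsum₁, rfl⟩ := (mem_ghValues_iff h₁).1 hc₁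
  obtain ⟨k₂, v₂, hv₂, hsum₂, rfl⟩ := (mem_ghValues_iff h₂).1 hc₂
  have hlaw₁ := isJointLaw_margS_apply h₁ (fun q => (hv₁ q).1) hsum₁
  have hlaw₂ := isJointLaw_margS_apply h₂ (fun q => (hv₂ q).1) hsum₂
  have hkron : kron (fun q => margS (v₁ q)) (fun q => margS (v₂ q))
      = fun q => margS (prodLaw (v₁ q.1) (v₂ q.2)) := by
    ext q s
    rw [margS_prodLaw, kron]
  rw [← mutualInfo_kron hlaw₁ hlaw₂, hkron]
  refine mutualInfo_margS_mem_ghValues (prodLaw_mem_stdSimplex h₁ h₂)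
    (fun q => prodLaw_mem_markovCone (hv₁ q.1) (hv₂ q.2)) ?_
  ext t
  rw [Finset.sum_apply, ← hsum₁, ← hsum₂]
  simp only [prodLaw, Finset.sum_apply]
  exact sum_prod_mul (fun q => v₁ q _) fun q => v₂ q _

theorem isGreatest_ghValues_prodLaw (h₁ : P₁ ∈ stdSimplex ℝ (S₁ × Y₁ × Z₁))
    (h₂ : P₂ ∈ stdSimplex ℝ (S₂ × Y₂ × Z₂)) (hc₁ : IsGreatest (ghValues P₁) c₁)
    (hc₂ : IsGreatest (ghValues P₂) c₂) :
    IsGreatest (ghValues (prodLaw P₁ P₂)) (c₁ + c₂) := by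
  have hP := prodLaw_mem_stdSimplex h₁ h₂
  refine ⟨add_mem_ghValues_prodLaw h₁ h₂ hc₁.1 hc₂.1, fun r hr => ?_⟩
  obtain ⟨k, v, hv, hsum, rfl⟩ := (mem_ghValues_iff hP).1 hr
  have hlaw := isJointLaw_margS_apply hP (fun q => (hv q).1) hsum
  have hmarg : ∀ s₁, ∑ q, ∑ s₂, margS (v q) (s₁, s₂) = margS P₁ s₁ := fun s₁ => by
    simp only [← margS_margFst]
    rw [sum_margS_apply, sum_margFst_apply, hsum, margFst_prodLaw P₁ h₂]
  refine mutualInfo_prod_le_add hlaw.nonneg hlaw.sum_eq_one ?_ fun s₁ hs₁ => ?_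
  · simp only [← margS_margFst]
    refine hc₁.2 (mutualInfo_margS_mem_ghValues h₁ (fun q => margFst_mem_markovCone (hv q)) ?_)
    rw [sum_margFst_apply, hsum, margFst_prodLaw P₁ h₂]
  · rw [hmarg] at hs₁
    have hcond : (fun q s₂ => margS (v q) (s₁, s₂) / margS P₁ s₁)
        = fun q => margS ((margS P₁ s₁)⁻¹ • restrictSnd (v q) s₁) := by
      ext q s₂
      rw [margS_smul, Pi.smul_apply, margS_restrictSnd, smul_eq_mul, div_eq_inv_mul]
    simp only [hmarg]
    rw [hcond]
    refine hc₂.2 (mutualInfo_margS_mem_ghValues h₂ (fun q => smul_mem_markovCone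
      (inv_nonneg.2 (margS_nonneg h₁.1 s₁)) (restrictSnd_mem_markovCone (hv q) s₁)) ?_)
    rw [← Finset.smul_sum, sum_restrictSnd_apply, hsum, restrictSnd_prodLaw, smul_smul,
      inv_mul_cancel₀ hs₁, one_smul]

theorem mutualInfo_margSY_prodLaw (h₁ : P₁ ∈ stdSimplex ℝ (S₁ × Y₁ × Z₁))
    (h₂ : P₂ ∈ stdSimplex ℝ (S₂ × Y₂ × Z₂)) : mutualInfo (margSY (prodLaw P₁ P₂))
      = mutualInfo (margSY P₁) + mutualInfo (margSY P₂) := by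
  rw [margSY_prodLaw, mutualInfo_kron (isJointLaw_margSY h₁) (isJointLaw_margSY h₂)]

theorem mutualInfo_margSZ_prodLaw (h₁ : P₁ ∈ stdSimplex ℝ (S₁ × Y₁ × Z₁))
    (h₂ : P₂ ∈ stdSimplex ℝ (S₂ × Y₂ × Z₂)) : mutualInfo (margSZ (prodLaw P₁ P₂))
      = mutualInfo (margSZ P₁) + mutualInfo (margSZ P₂) := by
  rw [margSZ_prodLaw, mutualInfo_kron (isJointLaw_margSZ h₁) (isJointLaw_margSZ h₂)]

theorem mutualInfo_prodLaw (h₁ : P₁ ∈ stdSimplex ℝ (S₁ × Y₁ × Z₁))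
    (h₂ : P₂ ∈ stdSimplex ℝ (S₂ × Y₂ × Z₂)) :
    mutualInfo (fun s yz => prodLaw P₁ P₂ (s, yz))
      = mutualInfo (fun s yz => P₁ (s, yz)) + mutualInfo (fun s yz => P₂ (s, yz)) := by
  rw [← mutualInfo_kron (isJointLaw_of_mem_stdSimplex h₁) (isJointLaw_of_mem_stdSimplex h₂)]
  exact (mutualInfo_comp_equiv (Equiv.refl _) (Equiv.prodProdProdComm Y₁ Z₁ Y₂ Z₂)
    (fun s yz => prodLaw P₁ P₂ (s, yz))).symm

end Product

section JointLaw

variable {Ω : Type x} [MeasurableSpace Ω] (μ : Measure Ω)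

theorem jointLaw_mem_stdSimplex [IsProbabilityMeasure μ] {A : Type u} {B : Type v} {C : Type w}
    [Fintype A] [Fintype B] [Fintype C] [MeasurableSpace A] [MeasurableSpace B]
    [MeasurableSpace C] [MeasurableSingletonClass A] [MeasurableSingletonClass B]
    [MeasurableSingletonClass C] {S : Ω → A} {Y : Ω → B} {Z : Ω → C} (hS : Measurable S)
    (hY : Measurable Y) (hZ : Measurable Z) : jointLaw μ S Y Z ∈ stdSimplex ℝ (A × B × C) := by
  refine ⟨fun t => measureReal_nonneg, ?_⟩
  have hmeas : Measurable fun ω => (S ω, Y ω, Z ω) := hS.prodMk (hY.prodMk hZ)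
  refine (sum_measureReal_preimage_singleton (μ := μ) Finset.univ
    fun t _ => hmeas (measurableSet_singleton t)).trans ?_
  rw [Finset.coe_univ, Set.preimage_univ, probReal_univ]

theorem jointLaw_prod {A₁ A₂ : Type u} {B₁ B₂ : Type v} {C₁ C₂ : Type w}
    [MeasurableSpace A₁] [MeasurableSpace A₂] [MeasurableSpace B₁] [MeasurableSpace B₂]
    [MeasurableSpace C₁] [MeasurableSpace C₂]
    [MeasurableSingletonClass A₁] [MeasurableSingletonClass A₂]
    [MeasurableSingletonClass B₁] [MeasurableSingletonClass B₂]
    [MeasurableSingletonClass C₁] [MeasurableSingletonClass C₂]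
    {S₁ : Ω → A₁} {S₂ : Ω → A₂} {Y₁ : Ω → B₁} {Y₂ : Ω → B₂} {Z₁ : Ω → C₁} {Z₂ : Ω → C₂}
    (h : IndepFun (fun ω => (S₁ ω, Y₁ ω, Z₁ ω)) (fun ω => (S₂ ω, Y₂ ω, Z₂ ω)) μ) :
    jointLaw μ (fun ω => (S₁ ω, S₂ ω)) (fun ω => (Y₁ ω, Y₂ ω)) (fun ω => (Z₁ ω, Z₂ ω))
      = prodLaw (jointLaw μ S₁ Y₁ Z₁) (jointLaw μ S₂ Y₂ Z₂) := by
  ext ⟨⟨a₁, a₂⟩, ⟨b₁, b₂⟩, ⟨c₁, c₂⟩⟩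
  have hindep := h.measure_inter_preimage_eq_mul {(a₁, b₁, c₁)} {(a₂, b₂, c₂)}
    (measurableSet_singleton _) (measurableSet_singleton _)
  simp only [prodLaw, jointLaw, Measure.real]
  rw [← ENNReal.toReal_mul]
  refine congrArg ENNReal.toReal (Eq.trans (congrArg μ ?_) hindep)
  ext ω
  simp only [Set.mem_ofPred_eq, Set.mem_inter_iff, Set.mem_preimage, Set.mem_singleton_iff,
    Prod.mk.injEq]
  tauto

end JointLaw

theorem isAdditive_of_prodLaw {I : InfoMeasure.{u, v, w}}
    (h : ∀ (S₁ S₂ : Type u) (Y₁ Y₂ : Type v) (Z₁ Z₂ : Type w) [Fintype S₁] [Fintype S₂]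
      [Fintype Y₁] [Fintype Y₂] [Fintype Z₁] [Fintype Z₂] (P₁ : S₁ × Y₁ × Z₁ → ℝ)
      (P₂ : S₂ × Y₂ × Z₂ → ℝ), P₁ ∈ stdSimplex ℝ (S₁ × Y₁ × Z₁) →
      P₂ ∈ stdSimplex ℝ (S₂ × Y₂ × Z₂) →
      I (S₁ × S₂) (Y₁ × Y₂) (Z₁ × Z₂) (prodLaw P₁ P₂) = I S₁ Y₁ Z₁ P₁ + I S₂ Y₂ Z₂ P₂) :
    IsAdditive.{u, v, w, x} I := by
  intro Ω _ μ _ A₁ A₂ B₁ B₂ C₁ C₂ _ _ _ _ _ _ _ _ _ _ _ _ _ _ _ _ _ _ S₁ S₂ Y₁ Y₂ Z₁ Z₂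
    hS₁ hS₂ hY₁ hY₂ hZ₁ hZ₂ hind
  rw [jointLaw_prod μ hind]
  exact h _ _ _ _ _ _ _ _ (jointLaw_mem_stdSimplex μ hS₁ hY₁ hZ₁)
    (jointLaw_mem_stdSimplex μ hS₂ hY₂ hZ₂)

theorem isAdditiveDecomposition_of_prodLaw {SI : InfoMeasure.{u, v, w}}
    (h : ∀ (S₁ S₂ : Type u) (Y₁ Y₂ : Type v) (Z₁ Z₂ : Type w) [Fintype S₁] [Fintype S₂]
      [Fintype Y₁] [Fintype Y₂] [Fintype Z₁] [Fintype Z₂] (P₁ : S₁ × Y₁ × Z₁ → ℝ)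
      (P₂ : S₂ × Y₂ × Z₂ → ℝ), P₁ ∈ stdSimplex ℝ (S₁ × Y₁ × Z₁) →
      P₂ ∈ stdSimplex ℝ (S₂ × Y₂ × Z₂) →
      SI (S₁ × S₂) (Y₁ × Y₂) (Z₁ × Z₂) (prodLaw P₁ P₂) = SI S₁ Y₁ Z₁ P₁ + SI S₂ Y₂ Z₂ P₂) :
    IsAdditiveDecomposition.{u, v, w, x} SI := by
  refine ⟨isAdditive_of_prodLaw h, isAdditive_of_prodLaw ?_, isAdditive_of_prodLaw ?_,
    isAdditive_of_prodLaw ?_⟩ <;>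
  · intro S₁ S₂ Y₁ Y₂ Z₁ Z₂ _ _ _ _ _ _ P₁ P₂ h₁ h₂
    simp only [complementary, uniqueY, uniqueZ, h _ _ _ _ _ _ P₁ P₂ h₁ h₂,
      mutualInfo_margSY_prodLaw h₁ h₂, mutualInfo_margSZ_prodLaw h₁ h₂, mutualInfo_prodLaw h₁ h₂]
    ring

end InfoDecomp

theorem mainTheorem1 :
    (∀ (S : Type u) (Y : Type v) (Z : Type w) [Fintype S] [Fintype Y] [Fintype Z]
      (P : S × Y × Z → ℝ), P ∈ stdSimplex ℝ (S × Y × Z) →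
        IsGreatest (InfoDecomp.wedgeValues P) (InfoDecomp.SIwedge S Y Z P) ∧
        IsGreatest (InfoDecomp.ghValues P) (InfoDecomp.SIgh S Y Z P) ∧
        IsGreatest (InfoDecomp.starValues P) (InfoDecomp.SIstar S Y Z P)) ∧
    InfoDecomp.IsAdditiveDecomposition.{u, v, w, x} InfoDecomp.SIwedge.{u, v, w} ∧
    InfoDecomp.IsAdditiveDecomposition.{u, v, w, x} InfoDecomp.SIgh.{u, v, w} ∧
    InfoDecomp.IsAdditiveDecomposition.{u, v, w, x} InfoDecomp.SIstar.{u, v, w} := by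
  refine ⟨fun S Y Z _ _ _ P hP => ⟨InfoDecomp.isGreatest_sSup_wedgeValues P,
    InfoDecomp.isGreatest_sSup_ghValues hP, InfoDecomp.isGreatest_sSup_starValues hP⟩,
    InfoDecomp.isAdditiveDecomposition_of_prodLaw ?_,
    InfoDecomp.isAdditiveDecomposition_of_prodLaw ?_,
    InfoDecomp.isAdditiveDecomposition_of_prodLaw ?_⟩
  · intro S₁ S₂ Y₁ Y₂ Z₁ Z₂ _ _ _ _ _ _ P₁ P₂ h₁ h₂
    exact (InfoDecomp.isGreatest_wedgeValues_prodLaw h₁ h₂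
      (InfoDecomp.isGreatest_sSup_wedgeValues P₁)
      (InfoDecomp.isGreatest_sSup_wedgeValues P₂)).csSup_eq
  · intro S₁ S₂ Y₁ Y₂ Z₁ Z₂ _ _ _ _ _ _ P₁ P₂ h₁ h₂
    exact (InfoDecomp.isGreatest_ghValues_prodLaw h₁ h₂ (InfoDecomp.isGreatest_sSup_ghValues h₁)
      (InfoDecomp.isGreatest_sSup_ghValues h₂)).csSup_eq
  · intro S₁ S₂ Y₁ Y₂ Z₁ Z₂ _ _ _ _ _ _ P₁ P₂ h₁ h₂
    exact (InfoDecomp.isGreatest_starValues_prodLaw h₁ h₂ (InfoDecomp.isGreatest_sSup_starValues h₁)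
      (InfoDecomp.isGreatest_sSup_starValues h₂)).csSup_eq
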